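/- Let $N\ge 1$ and $0<q<1$. Let $C_0(\mathbb R^N)$ be the space of continuous real functions on $\mathbb R^N$ vanishing at infinity, with the sup norm. For $t>0$ let $G_t(x)=(4\pi t)^{-N/2}e^{-|x|^2/(4t)}$, $\mathbf S(t)\varphi=G_t\star\varphi$ and $\mathbf S_\gamma(t)\varphi=G_t\star(|\cdot|^{-\gamma}\varphi)$, and let $\mathbf S(0)$ be the identity. For $0\le u_0\in C_0(\mathbb R^N)$, a non-negative solution of $$u_t-\Delta u=|x|^{-\gamma}u^q\ \text{ in } \mathbb R^N\times(0,\infty),\qquad u(\cdot,0)=u_0, \tag{P}$$ is a function $0\le u\in C([0,\infty);C_0(\mathbb R^N))$ such that $$u(t)=\mathbf S(t)u_0+\int_0^t\mathbf S_\gamma(t-\sigma)\,u^q(\sigma)\,d\sigma\qquad\text{for all } t\ge 0; \tag{I}$$ a sub-solution is such a function with $\le$ instead of $=$ in (I). (i) Let $0<\gamma<\min\{2,N\}$, and define $$\eta_0=(4\pi)^{-N/2}\int_{\mathbb R^N}e^{-|z|^2/4}(1+|z|)^{-\frac{\gamma}{1-q}}\,dz,$$ $$w(x,t)=[(1-q)\eta_0]^{\frac1{1-q}}\,t^{\frac1{1-q}}\,(|x|+\sqrt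 t)^{-\frac{\gamma}{1-q}}\quad(t>0),\qquad w(x,0)=0 .$$ If $0\le u_0\in C_0(\mathbb R^N)$, $u_0\ne0$, and $u$ is a non-negative solution of (P), then $u(x,t)>0$ for all $x\in\mathbb R^N$ and $t>0$, and $u(x,t)\ge w(x,t)$ for all $x\in\mathbb R^N$ and $t\ge0$. Moreover $w\in C([0,\infty);C_0(\mathbb R^N))$, and $w$ is a sub-solution of (P) with $u_0=0$. (ii) There is $\gamma^*\in(0,\min\{2,N\})$, depending only on $N$ and $q$, such that for every $0<\gamma<\gamma^*$ and every $0\le u_0\in C_0(\mathbb R^N)$ with $u_0\neq0$, any two non-negative solutions of (P) coincide. -/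

import Mathlib

open scoped ZeroAtInfty

/-- The Euclidean space `ℝ^N`, with its Euclidean norm and Lebesgue measure. -/
abbrev RN (N : ℕ) : Type := EuclideanSpace ℝ (Fin N)

/-- The heat kernel `G_t(x) = (4πt)^{-N/2} exp(-|x|² / (4t))`, meant for `t > 0`. -/
noncomputable def heatKernel (N : ℕ) (t : ℝ) (x : RN N) : ℝ :=
  (4 * Real.pi * t) ^ (-(N : ℝ) / 2) * Real.exp (-‖x‖ ^ 2 / (4 * t))

/-- The heat semigroup: `S(t)φ = G_t ⋆ φ` for `t > 0`, and `S(0)φ = φ`. -/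
noncomputable def heatS (N : ℕ) (t : ℝ) (φ : RN N → ℝ) (x : RN N) : ℝ :=
  if t = 0 then φ x else ∫ y, heatKernel N t (x - y) * φ y

/-- The operator `S_γ(t)φ = S(t)(|·|^{-γ} φ)`, `t > 0`. -/
noncomputable def heatSγ (N : ℕ) (γ t : ℝ) (φ : RN N → ℝ) (x : RN N) : ℝ :=
  ∫ y, heatKernel N t (x - y) * (‖y‖ ^ (-γ) * φ y)

/-- The right-hand side of the integral equation,
`S(t)u₀ + ∫₀ᵗ S_γ(t-σ) u(σ)^q dσ`, evaluated at the point `x`. -/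
noncomputable def duhamel (N : ℕ) (q γ : ℝ) (u₀ : C₀(RN N, ℝ)) (u : ℝ → C₀(RN N, ℝ))
    (t : ℝ) (x : RN N) : ℝ :=
  heatS N t u₀ x + ∫ σ in (0 : ℝ)..t, heatSγ N γ (t - σ) (fun y => u σ y ^ q) x

/-- `u` is a non-negative (mild) solution of `u_t - Δu = |x|^{-γ} u^q`, `u(0) = u₀`:
`u ∈ C([0,∞); C₀(ℝ^N))`, `u ≥ 0`, and the integral equation holds for every `t ≥ 0`.
Only the values of `u` at times `t ≥ 0` are relevant. -/
structure IsNonnegSolution (N : ℕ) (q γ : ℝ) (u₀ : C₀(RN N, ℝ)) (u : ℝ → C₀(RN N, ℝ)) :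
    Prop where
  continuousOn : ContinuousOn u (Set.Ici 0)
  nonneg : ∀ t, 0 ≤ t → ∀ x, 0 ≤ u t x
  eq_duhamel : ∀ t, 0 ≤ t → ∀ x, u t x = duhamel N q γ u₀ u t x

/-- `u` is a non-negative sub-solution: as above, with `≤` in the integral equation. -/
structure IsNonnegSubsolution (N : ℕ) (q γ : ℝ) (u₀ : C₀(RN N, ℝ)) (u : ℝ → C₀(RN N, ℝ)) :
    Prop where
  continuousOn : ContinuousOn u (Set.Ici 0)
  nonneg : ∀ t, 0 ≤ t → ∀ x, 0 ≤ u t x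
  le_duhamel : ∀ t, 0 ≤ t → ∀ x, u t x ≤ duhamel N q γ u₀ u t x

/-- `η₀ = (4π)^{-N/2} ∫ exp(-|z|²/4) (1+|z|)^{-γ/(1-q)} dz`. -/
noncomputable def eta₀ (N : ℕ) (q γ : ℝ) : ℝ :=
  (4 * Real.pi) ^ (-(N : ℝ) / 2) *
    ∫ z : RN N, Real.exp (-‖z‖ ^ 2 / 4) * (1 + ‖z‖) ^ (-γ / (1 - q))

/-- `w(x,t) = [(1-q)η₀]^{1/(1-q)} t^{1/(1-q)} (|x|+√t)^{-γ/(1-q)}`; it vanishes at `t = 0`. -/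
noncomputable def lowerBound (N : ℕ) (q γ : ℝ) (x : RN N) (t : ℝ) : ℝ :=
  ((1 - q) * eta₀ N q γ) ^ (1 / (1 - q)) * t ^ (1 / (1 - q)) *
    (‖x‖ + √t) ^ (-γ / (1 - q))

/-!
Why the theorem holds.

*Lower bound.* Put `p = -γ/(1-q)`. The operator `S_γ(t-σ)` applied to the `q`-th power of the
profile `B (|y| + √σ)^p` is at least `B^q η₀ (|x| + √t)^p` (`le_heatSγ_of_le`): one has
`|y|^{-γ} (|y| + √σ)^{pq} ≥ (|y| + √σ)^p`, and after parabolic rescaling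
`|x - √(t-σ) z| + √σ ≤ (|x| + √t)(1 + |z|)`. Integrating in `σ` shows that `lowerBound` is a
subsolution, and that lower bounds `θ * lowerBound` for a solution improve to
`θ^q * lowerBound`, hence to `lowerBound` itself since `θ^{q^n} → 1`. A solution need not a priori
dominate any multiple of `lowerBound`, because at infinity only a Gaussian bound is available (from
`exists_mul_exp_le_heatS`, after a small time shift). So the iteration is first run with a factor
`exp(-b|x|²)`: each step multiplies `b` by `(1+q)/2 < 1` at the cost of a fixed factor `κ` in the
constant, and the limit is a positive multiple of `lowerBound`
(`rpow_mul_lowerBound_le_of_mul_exp_le`).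

*Uniqueness.* The difference `z = |u - v|` of two solutions satisfies `z = O(t^α)` with
`α = (1 - γ/2)/(1 - q)`, from `|u^q - v^q| ≤ z^q` (`IsNonnegSolution.exists_abs_sub_le`). As both
solutions lie above `lowerBound`, the concavity of `s ↦ s^q` gives
`|y|^{-γ} |u^q - v^q| ≤ q / ((1-q) η₀ σ) * (1 + √σ/|y|)^γ z`. Inserting `z ≤ L t^α` yields
`z ≤ ρ L t^α` (`IsNonnegSolution.abs_sub_le_of_abs_sub_le`), where `ρ` depends on `N, q, γ` only
and `ρ → q` as `γ → 0`, because `η₀ → 1` and `1/α → 1 - q`. So `ρ < 1` for small `γ`, and `z = 0`.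
-/

open MeasureTheory Filter Topology Set

/-! ### The heat kernel -/

lemma heatKernel_pos {N : ℕ} {t : ℝ} (ht : 0 < t) (x : RN N) : 0 < heatKernel N t x := by
  unfold heatKernel
  have := Real.pi_pos
  positivity

@[fun_prop]
lemma continuous_heatKernel (N : ℕ) (t : ℝ) : Continuous (heatKernel N t) := by
  unfold heatKernel
  fun_prop

lemma heatKernel_smul {N : ℕ} {t : ℝ} (ht : 0 < t) (z : RN N) :
    √t ^ N * heatKernel N t (√t • z) = heatKernel N 1 z := by
  have hpi := Real.pi_pos
  have h1 : (4 * Real.pi * t) ^ (-(N : ℝ) / 2) = (4 * Real.pi) ^ (-(N : ℝ) / 2) * (√t ^ N)⁻¹ := by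
    rw [Real.mul_rpow (by positivity) ht.le, Real.sqrt_eq_rpow, ← Real.rpow_natCast,
      ← Real.rpow_mul ht.le, ← Real.rpow_neg ht.le]
    congr 2
    ring
  have h2 : -‖√t • z‖ ^ 2 / (4 * t) = -‖z‖ ^ 2 / 4 := by
    rw [norm_smul, Real.norm_of_nonneg (Real.sqrt_nonneg _), mul_pow, Real.sq_sqrt ht.le]
    field_simp
  have h3 : √t ^ N ≠ 0 := by positivity
  rw [heatKernel, heatKernel, h1, h2]
  simp only [mul_one]
  field_simp

/-- Parabolic rescaling of the heat convolution. -/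
lemma integral_heatKernel_mul {N : ℕ} {t : ℝ} (ht : 0 < t) (x : RN N) (f : RN N → ℝ) :
    ∫ y, heatKernel N t (x - y) * f y = ∫ z, heatKernel N 1 z * f (x - √t • z) := by
  have hs : 0 < √t ^ N := by positivity
  have h1 := Measure.integral_comp_smul (volume : Measure (RN N))
    (fun y => heatKernel N t y * f (x - y)) (√t)
  have h2 := integral_sub_left_eq_self (fun y => heatKernel N t (x - y) * f y) volume x
  simp only [sub_sub_cancel] at h2
  rw [h2] at h1
  rw [finrank_euclideanSpace, Fintype.card_fin, abs_of_pos (inv_pos.2 hs), smul_eq_mul] at h1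
  simp_rw [← heatKernel_smul ht, mul_assoc]
  rw [integral_const_mul, h1, mul_inv_cancel_left₀ hs.ne']

lemma integrable_heatKernel_mul_iff {N : ℕ} {t : ℝ} (ht : 0 < t) (x : RN N) (f : RN N → ℝ) :
    Integrable (fun y => heatKernel N t (x - y) * f y) ↔
      Integrable (fun z => heatKernel N 1 z * f (x - √t • z)) := by
  have hs : 0 < √t := by positivity
  have h1 := integrable_comp_smul_iff (volume : Measure (RN N))
    (fun y => heatKernel N t y * f (x - y)) hs.ne'
  have h2 := integrable_comp_sub_left (μ := volume) (fun y => heatKernel N t (x - y) * f y) x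
  simp only [sub_sub_cancel] at h2
  rw [← h2, ← h1]
  simp_rw [← heatKernel_smul ht, mul_assoc]
  exact (integrable_const_mul_iff (IsUnit.mk0 _ (by positivity)) _).symm

lemma integral_heatKernel_one (N : ℕ) : ∫ z, heatKernel N 1 z = 1 := by
  have hpi := Real.pi_pos
  have h := GaussianFourier.integral_rexp_neg_mul_sq_norm (V := RN N) (b := 1 / 4) (by norm_num)
  simp only [heatKernel, mul_one]
  rw [integral_const_mul]
  have h3 : ∀ z : RN N, -‖z‖ ^ 2 / 4 = -(1 / 4) * ‖z‖ ^ 2 := fun z => by ring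
  simp_rw [h3]
  rw [h, finrank_euclideanSpace, Fintype.card_fin]
  rw [show Real.pi / (1 / 4) = 4 * Real.pi by ring, ← Real.rpow_add (by positivity),
    show -(N : ℝ) / 2 + N / 2 = 0 by ring, Real.rpow_zero]

lemma integrable_heatKernel_one (N : ℕ) : Integrable (heatKernel N 1) :=
  Integrable.of_integral_ne_zero (by rw [integral_heatKernel_one]; norm_num)

lemma integral_heatKernel {N : ℕ} {t : ℝ} (ht : 0 < t) (x : RN N) :
    ∫ y, heatKernel N t (x - y) = 1 := by
  have := integral_heatKernel_mul ht x (fun _ => 1)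
  simpa [integral_heatKernel_one] using this

lemma integrable_heatKernel {N : ℕ} {t : ℝ} (ht : 0 < t) (x : RN N) :
    Integrable (fun y => heatKernel N t (x - y)) := by
  have := integrable_heatKernel_mul_iff ht x (fun _ => 1)
  simp only [mul_one] at this
  exact this.2 (integrable_heatKernel_one N)

lemma integrable_heatKernel_mul {N : ℕ} {t : ℝ} (ht : 0 < t) (x : RN N) {f : RN N → ℝ} {M : ℝ}
    (hf : AEStronglyMeasurable f) (hM : ∀ y, |f y| ≤ M) :
    Integrable (fun y => heatKernel N t (x - y) * f y) :=
  (integrable_heatKernel ht x).mul_bdd hf (c := M) (ae_of_all _ hM)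

lemma integrable_heatKernel_one_mul_norm (N : ℕ) :
    Integrable (fun z : RN N => heatKernel N 1 z * ‖z‖) := by
  have hpi := Real.pi_pos
  have h := GaussianFourier.integral_rexp_neg_mul_sq_norm (V := RN N) (b := 1 / 8) (by norm_num)
  have hi : Integrable (fun z : RN N => Real.exp (-(1 / 8) * ‖z‖ ^ 2)) :=
    Integrable.of_integral_ne_zero (by rw [h]; positivity)
  refine (hi.const_mul (8 * (4 * Real.pi) ^ (-(N : ℝ) / 2))).mono'
    (by fun_prop) (ae_of_all _ fun z => ?_)
  have h0 := heatKernel_pos one_pos z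
  rw [Real.norm_of_nonneg (by positivity)]
  simp only [heatKernel, mul_one]
  have h1 : ‖z‖ ≤ 8 * Real.exp (1 / 8 * ‖z‖ ^ 2) := by
    nlinarith [Real.add_one_le_exp (1 / 8 * ‖z‖ ^ 2), sq_nonneg (‖z‖ - 1)]
  have h2 : Real.exp (-‖z‖ ^ 2 / 4) =
      Real.exp (-(1 / 8) * ‖z‖ ^ 2) * Real.exp (-(1 / 8) * ‖z‖ ^ 2) := by
    rw [← Real.exp_add]; ring_nf
  have h3 : Real.exp (-(1 / 8) * ‖z‖ ^ 2) * Real.exp (1 / 8 * ‖z‖ ^ 2) = 1 := by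
    rw [← Real.exp_add]; simp
  rw [h2]
  calc _ = (4 * Real.pi) ^ (-(N : ℝ) / 2) * Real.exp (-(1 / 8) * ‖z‖ ^ 2) *
        (Real.exp (-(1 / 8) * ‖z‖ ^ 2) * ‖z‖) := by ring
    _ ≤ (4 * Real.pi) ^ (-(N : ℝ) / 2) * Real.exp (-(1 / 8) * ‖z‖ ^ 2) *
        (Real.exp (-(1 / 8) * ‖z‖ ^ 2) * (8 * Real.exp (1 / 8 * ‖z‖ ^ 2))) := by gcongr
    _ = _ := by
      rw [mul_left_comm (Real.exp _) 8, h3]; ring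

/-! ### Smoothing against the singular weight -/

lemma integrable_indicator_norm_rpow {N : ℕ} (hN : 1 ≤ N) {γ : ℝ} (hγ : γ < N) :
    Integrable ((Metric.ball (0 : RN N) 1).indicator fun y => ‖y‖ ^ (-γ)) := by
  rw [integrable_indicator_iff measurableSet_ball]
  refine integrableOn_ball_of_norm_le_rpow (C := 1) (α := γ) ?_ ?_ (ae_of_all _ fun y => ?_) ?_
  · simpa using hN
  · simpa using hγ
  · rw [Real.norm_of_nonneg (by positivity), one_mul]
  · exact (measurable_norm.pow_const _).aestronglyMeasurable

/-- The weight `|y|^{-γ}` costs the heat semigroup a factor `t^{-γ/2}`, uniformly in space. -/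
lemma exists_integral_heatKernel_mul_norm_rpow_le {N : ℕ} (hN : 1 ≤ N) {γ : ℝ} (h0 : 0 ≤ γ)
    (hγ : γ < N) :
    ∃ C : ℝ, 0 < C ∧ ∀ t : ℝ, 0 < t → ∀ x : RN N,
      Integrable (fun y => heatKernel N t (x - y) * ‖y‖ ^ (-γ)) ∧
      ∫ y, heatKernel N t (x - y) * ‖y‖ ^ (-γ) ≤ C * t ^ (-(γ / 2)) := by
  have hpi := Real.pi_pos
  set I : RN N → ℝ := (Metric.ball (0 : RN N) 1).indicator fun y => ‖y‖ ^ (-γ) with hI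
  have hIint : Integrable I := integrable_indicator_norm_rpow hN hγ
  have hI0 : ∀ y, 0 ≤ I y := fun y => indicator_nonneg (fun y _ => by positivity) y
  set K : ℝ := (4 * Real.pi) ^ (-(N : ℝ) / 2) with hK
  have hK0 : 0 < K := by positivity
  -- Near the singularity bound the kernel by its maximum, away from it bound the weight by `1`.
  have hpt : ∀ a z : RN N, heatKernel N 1 z * ‖a - z‖ ^ (-γ) ≤ K * I (a - z) + heatKernel N 1 z := by
    intro a z
    have hp := heatKernel_pos one_pos z
    by_cases h : a - z ∈ Metric.ball (0 : RN N) 1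
    · have hle : heatKernel N 1 z ≤ K := by
        simp only [heatKernel, mul_one, ← hK]
        refine mul_le_of_le_one_right hK0.le (Real.exp_le_one_iff.2 ?_)
        have := sq_nonneg ‖z‖
        linarith
      rw [hI, indicator_of_mem h]
      have : heatKernel N 1 z * ‖a - z‖ ^ (-γ) ≤ K * ‖a - z‖ ^ (-γ) := by gcongr
      linarith
    · have h1 : 1 ≤ ‖a - z‖ := by simpa using h
      have h2 : ‖a - z‖ ^ (-γ) ≤ 1 := Real.rpow_le_one_of_one_le_of_nonpos h1 (by linarith)
      have := hI0 (a - z)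
      have := mul_le_of_le_one_right hp.le h2
      have : 0 ≤ K * I (a - z) := by positivity
      linarith
  have hint : ∀ a : RN N, Integrable (fun z => K * I (a - z) + heatKernel N 1 z) := fun a =>
    ((hIint.comp_sub_left a).const_mul K).add (integrable_heatKernel_one N)
  have hint1 : ∀ a : RN N, Integrable (fun z => heatKernel N 1 z * ‖a - z‖ ^ (-γ)) := by
    intro a
    refine (hint a).mono' ?_ (ae_of_all _ fun z => ?_)
    · have : Measurable fun z : RN N => ‖a - z‖ ^ (-γ) :=
        (measurable_norm.comp (measurable_const.sub measurable_id)).pow_const _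
      exact (((continuous_heatKernel N 1).measurable).mul this).aestronglyMeasurable
    · have hp := heatKernel_pos one_pos z
      rw [Real.norm_of_nonneg (by positivity)]
      exact hpt a z
  refine ⟨K * (∫ y, I y) + 1, ?_, fun t ht x => ?_⟩
  · have : 0 ≤ ∫ y, I y := integral_nonneg hI0
    positivity
  have hs : 0 < √t := by positivity
  have hscale : ∀ z : RN N, heatKernel N 1 z * ‖x - √t • z‖ ^ (-γ) =
      t ^ (-(γ / 2)) * (heatKernel N 1 z * ‖(√t)⁻¹ • x - z‖ ^ (-γ)) := by
    intro z
    have h1 : x - √t • z = √t • ((√t)⁻¹ • x - z) := by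
      rw [smul_sub, smul_smul, mul_inv_cancel₀ hs.ne', one_smul]
    rw [h1, norm_smul, Real.norm_of_nonneg hs.le, Real.mul_rpow hs.le (norm_nonneg _),
      Real.sqrt_eq_rpow, ← Real.rpow_mul ht.le]
    ring_nf
  refine ⟨?_, ?_⟩
  · rw [integrable_heatKernel_mul_iff ht]
    simp_rw [hscale]
    exact (hint1 _).const_mul _
  · rw [integral_heatKernel_mul ht]
    simp_rw [hscale]
    rw [integral_const_mul, mul_comm]
    gcongr
    refine (integral_mono (hint1 _) (hint _) (hpt _)).trans ?_
    rw [integral_add ((hIint.comp_sub_left _).const_mul K) (integrable_heatKernel_one N),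
      integral_const_mul, integral_sub_left_eq_self, integral_heatKernel_one]

lemma integrable_heatKernel_mul_norm_rpow {N : ℕ} (hN : 1 ≤ N) {γ : ℝ} (h0 : 0 ≤ γ)
    (hγ : γ < N) {t : ℝ} (ht : 0 < t) (x : RN N) :
    Integrable (fun y => heatKernel N t (x - y) * ‖y‖ ^ (-γ)) := by
  obtain ⟨C, -, h⟩ := exists_integral_heatKernel_mul_norm_rpow_le hN h0 hγ
  exact (h t ht x).1

lemma integrable_heatSγ_integrand {N : ℕ} (hN : 1 ≤ N) {γ : ℝ} (h0 : 0 ≤ γ)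
    (hγ : γ < N) {t : ℝ} (ht : 0 < t) (x : RN N) {φ : RN N → ℝ} {M : ℝ}
    (hφ : AEStronglyMeasurable φ) (hM : ∀ y, |φ y| ≤ M) :
    Integrable (fun y => heatKernel N t (x - y) * (‖y‖ ^ (-γ) * φ y)) := by
  simp_rw [← mul_assoc]
  exact (integrable_heatKernel_mul_norm_rpow hN h0 hγ ht x).mul_bdd hφ (c := M) (ae_of_all _ hM)

lemma heatSγ_nonneg {N : ℕ} {γ t : ℝ} (ht : 0 < t) {φ : RN N → ℝ} (hφ : ∀ y, 0 ≤ φ y) (x : RN N) :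
    0 ≤ heatSγ N γ t φ x := by
  refine integral_nonneg fun y => ?_
  have := (heatKernel_pos ht (x - y)).le
  have := hφ y
  positivity

lemma heatS_nonneg {N : ℕ} {t : ℝ} (ht : 0 ≤ t) {φ : RN N → ℝ} (hφ : ∀ y, 0 ≤ φ y) (x : RN N) :
    0 ≤ heatS N t φ x := by
  unfold heatS
  split_ifs with h
  · exact hφ x
  refine integral_nonneg fun y => ?_
  have := (heatKernel_pos (lt_of_le_of_ne ht (Ne.symm h)) (x - y)).le
  have := hφ y
  positivity

lemma abs_heatSγ_le {N : ℕ} {γ t C : ℝ} (ht : 0 < t) (x : RN N)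
    (hC : Integrable (fun y => heatKernel N t (x - y) * ‖y‖ ^ (-γ)) ∧
      ∫ y, heatKernel N t (x - y) * ‖y‖ ^ (-γ) ≤ C * t ^ (-(γ / 2)))
    {φ : RN N → ℝ} {M : ℝ} (hM : ∀ y, |φ y| ≤ M) :
    |heatSγ N γ t φ x| ≤ C * M * t ^ (-(γ / 2)) := by
  have hM0 : 0 ≤ M := (abs_nonneg _).trans (hM 0)
  have h := norm_integral_le_of_norm_le (f := fun y => heatKernel N t (x - y) * (‖y‖ ^ (-γ) * φ y))
    (hC.1.mul_const M) (ae_of_all _ fun y => ?_)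
  · rw [integral_mul_const, Real.norm_eq_abs] at h
    refine h.trans ?_
    calc _ ≤ C * t ^ (-(γ / 2)) * M := by gcongr; exact hC.2
      _ = _ := by ring
  · have := (heatKernel_pos ht (x - y))
    rw [norm_mul, norm_mul, Real.norm_of_nonneg this.le, Real.norm_of_nonneg (by positivity),
      Real.norm_eq_abs, ← mul_assoc]
    gcongr
    exact hM y

lemma integral_sub_rpow {γ t : ℝ} (hγ : γ < 2) :
    ∫ σ in (0 : ℝ)..t, (t - σ) ^ (-(γ / 2)) = t ^ (1 - γ / 2) / (1 - γ / 2) := by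
  rw [intervalIntegral.integral_comp_sub_left (fun s => s ^ (-(γ / 2))) t]
  rw [integral_rpow (Or.inl (by linarith))]
  rw [sub_self, sub_zero, Real.zero_rpow (by linarith)]
  ring_nf

lemma intervalIntegrable_sub_rpow {γ t : ℝ} (hγ : γ < 2) :
    IntervalIntegrable (fun σ => (t - σ) ^ (-(γ / 2))) volume 0 t := by
  have h1 := intervalIntegral.intervalIntegrable_rpow' (a := 0) (b := t) (r := -(γ / 2))
    (by linarith)
  simpa using (h1.comp_sub_left t).symm

/-- The integrand of the Duhamel term is integrable in time: it is measurable by Fubini and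
bounded by a multiple of `(t - σ)^{-γ/2}`, where `γ < 2`. -/
lemma intervalIntegrable_heatSγ {N : ℕ} (hN : 1 ≤ N) {γ : ℝ} (h0 : 0 ≤ γ)
    (hγ : γ < min 2 (N : ℝ)) {t : ℝ} (ht : 0 ≤ t) (x : RN N) {f : ℝ → RN N → ℝ} {M : ℝ}
    (hf : ContinuousOn (Function.uncurry f) (Ioi 0 ×ˢ univ))
    (hM : ∀ σ, 0 < σ → σ < t → ∀ y, |f σ y| ≤ M) :
    IntervalIntegrable (fun σ => heatSγ N γ (t - σ) (f σ) x) volume 0 t := by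
  obtain ⟨C, hC0, hC⟩ := exists_integral_heatKernel_mul_norm_rpow_le hN h0
    (hγ.trans_le (min_le_right _ _))
  have hγ2 : γ < 2 := hγ.trans_le (min_le_left _ _)
  have hbd : IntervalIntegrable (fun σ => C * M * (t - σ) ^ (-(γ / 2))) volume 0 t :=
    (intervalIntegrable_sub_rpow hγ2).const_mul _
  rw [intervalIntegrable_iff_integrableOn_Ioo_of_le ht] at hbd ⊢
  refine Integrable.mono' hbd ?_ ?_
  · have hmeas : AEStronglyMeasurable (fun p : ℝ × RN N =>
        heatKernel N (t - p.1) (x - p.2) * (‖p.2‖ ^ (-γ) * Function.uncurry f p))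
        ((volume.restrict (Ioo 0 t)).prod volume) := by
      have e1 : Measurable fun p : ℝ × RN N => heatKernel N (t - p.1) (x - p.2) := by
        unfold heatKernel
        fun_prop
      have e2 : Measurable fun p : ℝ × RN N => ‖p.2‖ ^ (-γ) := by fun_prop
      have e3 : AEStronglyMeasurable (Function.uncurry f)
          ((volume.restrict (Ioo 0 t)).prod volume) := by
        have h3 := hf.aestronglyMeasurable (μ := (volume : Measure (ℝ × RN N)))
          (measurableSet_Ioi.prod MeasurableSet.univ)
        have h4 : (volume.restrict (Ioo 0 t)).prod (volume : Measure (RN N)) =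
            (volume : Measure (ℝ × RN N)).restrict (Ioo 0 t ×ˢ univ) := by
          rw [Measure.volume_eq_prod, ← Measure.prod_restrict, Measure.restrict_univ]
        rw [h4]
        exact h3.mono_measure (Measure.restrict_mono (Set.prod_mono Ioo_subset_Ioi_self le_rfl) le_rfl)
      exact e1.aestronglyMeasurable.mul (e2.aestronglyMeasurable.mul e3)
    exact hmeas.integral_prod_right'
  · refine (ae_restrict_iff' measurableSet_Ioo).2 (ae_of_all _ fun σ hσ => ?_)
    exact abs_heatSγ_le (sub_pos.2 hσ.2) x (hC _ (sub_pos.2 hσ.2) x) (hM σ hσ.1 hσ.2)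

/-! ### Continuous curves in `C₀(ℝ^N)` -/

lemma ZeroAtInftyContinuousMap.abs_apply_le_norm {X : Type*} [TopologicalSpace X] (f : C₀(X, ℝ))
    (x : X) : |f x| ≤ ‖f‖ :=
  f.toBCF.norm_coe_le_norm x

lemma ZeroAtInftyContinuousMap.norm_le_of_abs_le {X : Type*} [TopologicalSpace X] {f : C₀(X, ℝ)}
    {M : ℝ} (hM : 0 ≤ M) (h : ∀ x, |f x| ≤ M) : ‖f‖ ≤ M :=
  (BoundedContinuousFunction.norm_le hM).2 h

lemma continuousOn_uncurry_of_continuousOn {N : ℕ} {u : ℝ → C₀(RN N, ℝ)}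
    (hu : ContinuousOn u (Ici 0)) :
    ContinuousOn (fun p : ℝ × RN N => u p.1 p.2) (Ici 0 ×ˢ univ) := by
  have h1 : ContinuousOn (fun p : ℝ × RN N => (u p.1).toBCF) (Ici 0 ×ˢ univ) :=
    ZeroAtInftyContinuousMap.isometry_toBCF.continuous.comp_continuousOn
      (hu.comp continuousOn_fst fun p hp => hp.1)
  exact continuous_eval.comp_continuousOn (h1.prodMk continuousOn_snd)

lemma exists_forall_abs_apply_le {N : ℕ} {u : ℝ → C₀(RN N, ℝ)} (hu : ContinuousOn u (Ici 0))
    (T : ℝ) : ∃ M : ℝ, ∀ σ, 0 ≤ σ → σ ≤ T → ∀ y, |u σ y| ≤ M := by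
  obtain ⟨M, hM⟩ := isCompact_Icc.exists_bound_of_continuousOn
    (hu.mono (Icc_subset_Ici_self : Icc 0 T ⊆ Ici 0))
  exact ⟨M, fun σ h0 hT y => ((u σ).abs_apply_le_norm y).trans (hM σ ⟨h0, hT⟩)⟩

lemma abs_rpow_le_rpow {a M q : ℝ} (hq : 0 ≤ q) (ha : 0 ≤ a) (h : |a| ≤ M) : |a ^ q| ≤ M ^ q := by
  rw [abs_of_nonneg ha] at h
  rw [abs_of_nonneg (by positivity)]
  gcongr

lemma intervalIntegrable_heatSγ_rpow {N : ℕ} (hN : 1 ≤ N) {q γ : ℝ} (hq0 : 0 < q) (h0 : 0 ≤ γ)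
    (hγ : γ < min 2 (N : ℝ)) {u : ℝ → C₀(RN N, ℝ)} (hu : ContinuousOn u (Ici 0))
    (hu0 : ∀ t, 0 ≤ t → ∀ x, 0 ≤ u t x) {t : ℝ} (ht : 0 ≤ t) (x : RN N) :
    IntervalIntegrable (fun σ => heatSγ N γ (t - σ) (fun y => u σ y ^ q) x) volume 0 t := by
  obtain ⟨M, hM⟩ := exists_forall_abs_apply_le hu t
  refine intervalIntegrable_heatSγ hN h0 hγ ht x (f := fun σ y => u σ y ^ q) (M := M ^ q) ?_ ?_
  · have h1 := (continuousOn_uncurry_of_continuousOn hu).mono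
      (Set.prod_mono Ioi_subset_Ici_self le_rfl : Ioi (0 : ℝ) ×ˢ univ ⊆ Ici 0 ×ˢ univ)
    exact h1.rpow_const fun p _ => Or.inr hq0.le
  · exact fun σ h1 h2 y => abs_rpow_le_rpow hq0.le (hu0 σ h1.le y) (hM σ h1.le h2.le y)

/-! ### Positivity -/

/-- For `t` in a compact subinterval of `(0, ∞)`, the heat flow of a nontrivial nonnegative
datum lies above a fixed Gaussian. -/
lemma exists_mul_exp_le_heatS {N : ℕ} {u₀ : C₀(RN N, ℝ)} (h0 : ∀ x, 0 ≤ u₀ x) (hne : u₀ ≠ 0)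
    {τ T : ℝ} (hτ : 0 < τ) (hT : τ ≤ T) :
    ∃ c : ℝ, 0 < c ∧ ∀ t, τ ≤ t → t ≤ T → ∀ x : RN N,
      c * Real.exp (-(1 / (2 * τ)) * ‖x‖ ^ 2) ≤ heatS N t u₀ x := by
  have hpi := Real.pi_pos
  obtain ⟨x₀, hx₀⟩ : ∃ x₀, 0 < u₀ x₀ := by
    by_contra! h
    exact hne (ZeroAtInftyContinuousMap.ext fun x => le_antisymm (h x) (h0 x))
  obtain ⟨r, hr, hball⟩ : ∃ r > 0, ∀ y ∈ Metric.ball x₀ r, u₀ x₀ / 2 < u₀ y := by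
    have h := (map_continuous u₀).continuousAt.eventually (lt_mem_nhds (half_lt_self hx₀))
    exact Metric.eventually_nhds_iff_ball.1 h
  set δ := u₀ x₀ / 2 with hδ
  have hδ0 : 0 < δ := by positivity
  set R := ‖x₀‖ + r with hR
  set V := (volume : Measure (RN N)).real (Metric.ball x₀ r) with hV
  have hV0 : 0 < V := ENNReal.toReal_pos (Metric.measure_ball_pos _ _ hr).ne'
    measure_ball_lt_top.ne
  have hT0 : 0 < T := hτ.trans_le hT
  set k := (4 * Real.pi * T) ^ (-(N : ℝ) / 2) with hk
  have hk0 : 0 < k := by positivity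
  refine ⟨V * (k * Real.exp (-(1 / (2 * τ)) * R ^ 2) * δ), by positivity, fun t h1 h2 x => ?_⟩
  have ht : 0 < t := hτ.trans_le h1
  obtain ⟨M, hM⟩ : ∃ M, ∀ y, |u₀ y| ≤ M := ⟨‖u₀‖, u₀.abs_apply_le_norm⟩
  have hint := integrable_heatKernel_mul ht x (map_continuous u₀).aestronglyMeasurable hM
  rw [heatS, if_neg ht.ne']
  set m := k * Real.exp (-(1 / (2 * τ)) * R ^ 2) * δ * Real.exp (-(1 / (2 * τ)) * ‖x‖ ^ 2) with hm
  have hle : ∫ y, (Metric.ball x₀ r).indicator (fun _ => m) y ≤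
      ∫ y, heatKernel N t (x - y) * u₀ y := by
    refine integral_mono ((integrable_indicator_iff measurableSet_ball).2
      (integrableOn_const measure_ball_lt_top.ne)) hint fun y => ?_
    have hp := (heatKernel_pos ht (x - y)).le
    by_cases hy : y ∈ Metric.ball x₀ r
    · rw [indicator_of_mem hy]
      have hyR : ‖y‖ ≤ R := by
        have := norm_le_norm_add_norm_sub' y x₀
        rw [mem_ball_iff_norm] at hy
        linarith
      have hsq : ‖x - y‖ ^ 2 ≤ 2 * R ^ 2 + 2 * ‖x‖ ^ 2 := by
        have h3 := norm_sub_le x y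
        have h4 := norm_nonneg y
        have h5 := norm_nonneg (x - y)
        have h6 : ‖x - y‖ ^ 2 ≤ (‖x‖ + ‖y‖) ^ 2 := by gcongr
        have h7 : ‖y‖ ^ 2 ≤ R ^ 2 := by gcongr
        nlinarith [sq_nonneg (‖x‖ - ‖y‖)]
      have hker : k * Real.exp (-(1 / (2 * τ)) * R ^ 2) * Real.exp (-(1 / (2 * τ)) * ‖x‖ ^ 2) ≤
          heatKernel N t (x - y) := by
        rw [heatKernel, mul_assoc, ← Real.exp_add]
        gcongr ?_ * ?_
        · refine Real.rpow_le_rpow_of_nonpos (by positivity) (by gcongr) ?_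
          have : (0 : ℝ) ≤ N := N.cast_nonneg
          linarith
        · refine Real.exp_le_exp.2 ?_
          have : ‖x - y‖ ^ 2 / (4 * t) ≤ (2 * R ^ 2 + 2 * ‖x‖ ^ 2) / (4 * τ) := by gcongr
          rw [neg_div]
          have e : (2 * R ^ 2 + 2 * ‖x‖ ^ 2) / (4 * τ) =
            1 / (2 * τ) * R ^ 2 + 1 / (2 * τ) * ‖x‖ ^ 2 := by field_simp; ring
          linarith
      calc m = k * Real.exp (-(1 / (2 * τ)) * R ^ 2) * Real.exp (-(1 / (2 * τ)) * ‖x‖ ^ 2) * δ := by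
            rw [hm]; ring
        _ ≤ _ := mul_le_mul hker (hball y hy).le hδ0.le hp
    · rw [indicator_of_notMem hy]
      exact mul_nonneg hp (h0 y)
  rw [integral_indicator measurableSet_ball, setIntegral_const, smul_eq_mul, ← hV] at hle
  calc _ = V * m := by rw [hm]; ring
    _ ≤ _ := hle

lemma heatS_le_duhamel {N : ℕ} {q γ : ℝ} (u₀ : C₀(RN N, ℝ)) {u : ℝ → C₀(RN N, ℝ)}
    (hu0 : ∀ t, 0 ≤ t → ∀ x, 0 ≤ u t x) {t : ℝ} (ht : 0 ≤ t) (x : RN N) :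
    heatS N t u₀ x ≤ duhamel N q γ u₀ u t x := by
  rw [duhamel, le_add_iff_nonneg_right, intervalIntegral.integral_of_le ht,
    integral_Ioc_eq_integral_Ioo]
  refine setIntegral_nonneg measurableSet_Ioo fun σ hσ => ?_
  exact heatSγ_nonneg (sub_pos.2 hσ.2) (fun y => Real.rpow_nonneg (hu0 σ hσ.1.le y) q) x

lemma IsNonnegSolution.pos {N : ℕ} {q γ : ℝ} {u₀ : C₀(RN N, ℝ)} {u : ℝ → C₀(RN N, ℝ)}
    (hu : IsNonnegSolution N q γ u₀ u) (h0 : ∀ x, 0 ≤ u₀ x) (hne : u₀ ≠ 0) {t : ℝ} (ht : 0 < t)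
    (x : RN N) : 0 < u t x := by
  obtain ⟨c, hc, h⟩ := exists_mul_exp_le_heatS h0 hne ht le_rfl
  rw [hu.eq_duhamel t ht.le x]
  exact (by positivity : 0 < c * Real.exp (-(1 / (2 * t)) * ‖x‖ ^ 2)).trans_le
    ((h t le_rfl le_rfl x).trans (heatS_le_duhamel u₀ hu.nonneg ht.le x))

/-! ### Propagation of lower bounds through the Duhamel term -/

/-- The Gaussian-weighted variant of `eta₀`, in which the integrand carries the extra factor
`exp(-c|z|²)`. -/
noncomputable def weightedEta (N : ℕ) (q γ c : ℝ) : ℝ :=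
  ∫ z : RN N, heatKernel N 1 z * ((1 + ‖z‖) ^ (-γ / (1 - q)) * Real.exp (-c * ‖z‖ ^ 2))

lemma continuous_one_add_norm_rpow (N : ℕ) (p : ℝ) :
    Continuous fun z : RN N => (1 + ‖z‖) ^ p :=
  (continuous_const.add continuous_norm).rpow_const fun z =>
    Or.inl (add_pos_of_pos_of_nonneg one_pos (norm_nonneg z)).ne'

lemma neg_div_one_sub_nonpos {q γ : ℝ} (hq1 : q < 1) (h0 : 0 ≤ γ) : -γ / (1 - q) ≤ 0 :=
  div_nonpos_of_nonpos_of_nonneg (by linarith) (by linarith)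

lemma integrable_weightedEta (N : ℕ) {q γ c : ℝ} (hq1 : q < 1) (h0 : 0 ≤ γ) (hc : 0 ≤ c) :
    Integrable fun z : RN N =>
      heatKernel N 1 z * ((1 + ‖z‖) ^ (-γ / (1 - q)) * Real.exp (-c * ‖z‖ ^ 2)) := by
  refine (integrable_heatKernel_one N).mul_bdd (c := 1)
    ((continuous_one_add_norm_rpow N _).mul (by fun_prop)).aestronglyMeasurable
    (ae_of_all _ fun z => ?_)
  have hz := norm_nonneg z
  rw [Real.norm_of_nonneg (by positivity)]
  refine mul_le_one₀ (Real.rpow_le_one_of_one_le_of_nonpos (by linarith)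
    (neg_div_one_sub_nonpos hq1 h0)) (by positivity) (Real.exp_le_one_iff.2 ?_)
  nlinarith [sq_nonneg ‖z‖]

lemma weightedEta_zero (N : ℕ) (q γ : ℝ) : weightedEta N q γ 0 = eta₀ N q γ := by
  simp only [weightedEta, eta₀, heatKernel, neg_zero, zero_mul, Real.exp_zero, mul_one, mul_assoc]
  rw [integral_const_mul]

lemma weightedEta_anti {N : ℕ} {q γ c d : ℝ} (hq1 : q < 1) (h0 : 0 ≤ γ) (hc : 0 ≤ c)
    (hcd : c ≤ d) : weightedEta N q γ d ≤ weightedEta N q γ c := by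
  refine integral_mono (integrable_weightedEta N hq1 h0 (hc.trans hcd))
    (integrable_weightedEta N hq1 h0 hc) fun z => ?_
  have := heatKernel_pos one_pos z
  have hz := norm_nonneg z
  dsimp only
  gcongr

lemma weightedEta_pos {N : ℕ} {q γ c : ℝ} (hq1 : q < 1) (h0 : 0 ≤ γ) (hc : 0 ≤ c) :
    0 < weightedEta N q γ c := by
  have hp : ∀ z : RN N, 0 <
      heatKernel N 1 z * ((1 + ‖z‖) ^ (-γ / (1 - q)) * Real.exp (-c * ‖z‖ ^ 2)) := fun z => by
    have := heatKernel_pos one_pos z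
    have hz := norm_nonneg z
    positivity
  refine (integral_pos_iff_support_of_nonneg (fun z => (hp z).le)
    (integrable_weightedEta N hq1 h0 hc)).2 ?_
  rw [Function.support_eq_univ fun z => (hp z).ne']
  exact isOpen_univ.measure_pos _ univ_nonempty

lemma eta₀_pos (N : ℕ) {q γ : ℝ} (hq1 : q < 1) (h0 : 0 ≤ γ) : 0 < eta₀ N q γ := by
  rw [← weightedEta_zero]
  exact weightedEta_pos hq1 h0 le_rfl

/-- The constant is the price of replacing `|x - z|²` by `|x|²` in a Gaussian raised to the power
`q`, while still improving its rate by a factor `(1 + q) / 2 < 1`. -/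
lemma mul_sq_le_of_le_add {q a b d : ℝ} (hq0 : 0 < q) (hq1 : q < 1) (hd : 0 ≤ d)
    (h : d ≤ a + b) :
    q * d ^ 2 ≤ (1 + q) / 2 * a ^ 2 + q * (1 + q) / (1 - q) * b ^ 2 := by
  have h1 : 0 < 1 - q := by linarith
  have h2 : q * d ^ 2 ≤ q * (a + b) ^ 2 := by gcongr
  have h3 : (1 + q) / 2 * a ^ 2 + q * (1 + q) / (1 - q) * b ^ 2 - q * (a + b) ^ 2 =
      ((1 - q) * a - 2 * q * b) ^ 2 / (2 * (1 - q)) := by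
    field_simp
    ring
  have h4 : 0 ≤ ((1 - q) * a - 2 * q * b) ^ 2 / (2 * (1 - q)) := by positivity
  linarith

/-- A lower bound by the profile `(|y| + √σ)^{-γ/(1-q)}`, damped by a Gaussian, is reproduced by
`φ ↦ S_γ(t-σ) φ^q` with `√σ` replaced by `√t`, and the rate of the Gaussian drops by the
factor `(1 + q) / 2`. -/
lemma le_heatSγ_of_le {N : ℕ} (hN : 1 ≤ N) {q γ : ℝ} (hq0 : 0 < q) (hq1 : q < 1) (h0 : 0 ≤ γ)
    (hγ : γ < N) {σ t B b M : ℝ} (hσ : 0 < σ) (hσt : σ < t) (hB : 0 ≤ B) (hb : 0 ≤ b)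
    {φ : RN N → ℝ} (hφ : Continuous φ) (hM : ∀ y, |φ y| ≤ M)
    (h : ∀ y, B * (‖y‖ + √σ) ^ (-γ / (1 - q)) * Real.exp (-b * ‖y‖ ^ 2) ≤ φ y) (x : RN N) :
    B ^ q * (‖x‖ + √t) ^ (-γ / (1 - q)) * Real.exp (-((1 + q) / 2 * b) * ‖x‖ ^ 2) *
      weightedEta N q γ (q * (1 + q) / (1 - q) * b * t) ≤
      heatSγ N γ (t - σ) (fun y => φ y ^ q) x := by
  have hq2 : 0 < 1 - q := by linarith
  have hs : 0 < √σ := by positivity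
  have ht : 0 < t := hσ.trans hσt
  have htσ : 0 < t - σ := sub_pos.2 hσt
  set p := -γ / (1 - q) with hp
  have hp0 : p ≤ 0 := neg_div_one_sub_nonpos hq1 h0
  have hpq : -γ + p * q = p := by
    rw [hp]; field_simp; ring
  have hφ0 : ∀ y, 0 ≤ φ y := fun y => le_trans (by positivity) (h y)
  have : Nontrivial (RN N) :=
    Module.nontrivial_of_finrank_pos (R := ℝ) (by rw [finrank_euclideanSpace, Fintype.card_fin]; exact hN)
  set ψ : RN N → ℝ := fun y => B ^ q * (‖y‖ + √σ) ^ p * Real.exp (-(q * b) * ‖y‖ ^ 2) with hψ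
  have hψc : Continuous ψ := by
    refine (continuous_const.mul ?_).mul (by fun_prop)
    exact (continuous_norm.add continuous_const).rpow_const fun z =>
      Or.inl (add_pos_of_nonneg_of_pos (norm_nonneg z) hs).ne'
  have hψ0 : ∀ y, 0 ≤ ψ y := fun y => by positivity
  have hψb : ∀ y, |ψ y| ≤ B ^ q * √σ ^ p := fun y => by
    rw [abs_of_nonneg (hψ0 y)]
    have e1 : (‖y‖ + √σ) ^ p ≤ √σ ^ p :=
      Real.rpow_le_rpow_of_nonpos hs (by have := norm_nonneg y; linarith) hp0
    have e2 : Real.exp (-(q * b) * ‖y‖ ^ 2) ≤ 1 := Real.exp_le_one_iff.2 (by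
      have : 0 ≤ q * b * ‖y‖ ^ 2 := by positivity
      linarith)
    calc ψ y ≤ B ^ q * √σ ^ p * 1 := by dsimp only [ψ]; gcongr
      _ = _ := mul_one _
  -- The origin is excluded because there `‖y‖ ^ (-γ)` takes the junk value `0`.
  have key : ∀ y : RN N, y ≠ 0 → ψ y ≤ ‖y‖ ^ (-γ) * φ y ^ q := by
    intro y hy
    have hy0 : 0 < ‖y‖ := norm_pos_iff.2 hy
    have e1 : (‖y‖ + √σ) ^ (-γ) ≤ ‖y‖ ^ (-γ) :=
      Real.rpow_le_rpow_of_nonpos hy0 (by linarith) (by linarith)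
    have e2 : (B * (‖y‖ + √σ) ^ p * Real.exp (-b * ‖y‖ ^ 2)) ^ q ≤ φ y ^ q := by
      gcongr
      exact h y
    rw [Real.mul_rpow (by positivity) (by positivity), Real.mul_rpow hB (by positivity),
      ← Real.rpow_mul (by positivity), ← Real.exp_mul] at e2
    calc ψ y = (‖y‖ + √σ) ^ (-γ) *
          (B ^ q * (‖y‖ + √σ) ^ (p * q) * Real.exp (-b * ‖y‖ ^ 2 * q)) := by
          rw [hψ]
          dsimp only
          nth_rewrite 1 [← hpq]
          rw [Real.rpow_add (by positivity)]
          ring_nf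
      _ ≤ _ := by gcongr
  have hint1 := integrable_heatKernel_mul htσ x hψc.aestronglyMeasurable hψb
  have step1 : ∫ y, heatKernel N (t - σ) (x - y) * ψ y ≤
      heatSγ N γ (t - σ) (fun y => φ y ^ q) x := by
    refine integral_mono_ae hint1 ?_ ?_
    · refine integrable_heatSγ_integrand hN h0 hγ htσ x
        (hφ.rpow_const fun _ => Or.inr hq0.le).aestronglyMeasurable (M := M ^ q) fun y => ?_
      exact abs_rpow_le_rpow hq0.le (hφ0 y) (hM y)
    · filter_upwards [compl_mem_ae_iff.2 (measure_singleton (μ := volume) (0 : RN N))] with y hy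
      have := heatKernel_pos htσ (x - y)
      exact mul_le_mul_of_nonneg_left (key y hy) this.le
  refine le_trans ?_ step1
  rw [integral_heatKernel_mul htσ, weightedEta, ← integral_const_mul]
  refine integral_mono ((integrable_weightedEta N hq1 h0 (by positivity)).const_mul _)
    ((integrable_heatKernel_mul_iff htσ x ψ).1 hint1) fun z => ?_
  have hG := heatKernel_pos one_pos z
  have hz := norm_nonneg z
  have hx := norm_nonneg x
  have hst : 0 < √t := by positivity
  have hroot : √(t - σ) ≤ √t := Real.sqrt_le_sqrt (by linarith)
  have hnorm : ‖x - √(t - σ) • z‖ ≤ ‖x‖ + √t * ‖z‖ := by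
    refine (norm_sub_le _ _).trans ?_
    rw [norm_smul, Real.norm_of_nonneg (Real.sqrt_nonneg _)]
    gcongr
  have e1 : ((‖x‖ + √t) * (1 + ‖z‖)) ^ p ≤ (‖x - √(t - σ) • z‖ + √σ) ^ p := by
    refine Real.rpow_le_rpow_of_nonpos (by positivity) ?_ hp0
    have : √σ ≤ √t := Real.sqrt_le_sqrt hσt.le
    nlinarith [mul_nonneg hx hz]
  rw [Real.mul_rpow (by positivity) (by positivity)] at e1
  have e2 : Real.exp (-((1 + q) / 2 * b) * ‖x‖ ^ 2) *
      Real.exp (-(q * (1 + q) / (1 - q) * b * t) * ‖z‖ ^ 2) ≤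
      Real.exp (-(q * b) * ‖x - √(t - σ) • z‖ ^ 2) := by
    rw [← Real.exp_add]
    refine Real.exp_le_exp.2 ?_
    have := mul_sq_le_of_le_add hq0 hq1 (norm_nonneg _) hnorm
    rw [mul_pow, Real.sq_sqrt ht.le] at this
    have := mul_le_mul_of_nonneg_left this hb
    linarith
  calc _ = heatKernel N 1 z * (B ^ q * ((‖x‖ + √t) ^ p * (1 + ‖z‖) ^ p) *
        (Real.exp (-((1 + q) / 2 * b) * ‖x‖ ^ 2) *
          Real.exp (-(q * (1 + q) / (1 - q) * b * t) * ‖z‖ ^ 2))) := by ring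
    _ ≤ heatKernel N 1 z * ψ (x - √(t - σ) • z) := by
        rw [hψ]
        dsimp only
        gcongr

/-- The constant in `lowerBound` makes the time integration close up exactly: if
`A = ((1-q)η₀)^{1/(1-q)}`, then `A^q η₀ (1-q) = A`. -/
lemma mul_lowerBound_le_integral_heatSγ {N : ℕ} (hN : 1 ≤ N) {q γ : ℝ} (hq0 : 0 < q) (hq1 : q < 1)
    (h0 : 0 ≤ γ) (hγ : γ < min 2 (N : ℝ)) {U : ℝ → C₀(RN N, ℝ)} (hU : ContinuousOn U (Ici 0))
    (hU0 : ∀ t, 0 ≤ t → ∀ x, 0 ≤ U t x) {t θ κ b : ℝ} (ht : 0 < t) (hθ : 0 ≤ θ) (hb : 0 ≤ b)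
    (hκ : κ * eta₀ N q γ ≤ weightedEta N q γ (q * (1 + q) / (1 - q) * b * t))
    (h : ∀ σ, 0 < σ → σ < t → ∀ y,
      θ * lowerBound N q γ y σ * Real.exp (-b * ‖y‖ ^ 2) ≤ U σ y) (x : RN N) :
    θ ^ q * κ * lowerBound N q γ x t * Real.exp (-((1 + q) / 2 * b) * ‖x‖ ^ 2) ≤
      ∫ σ in (0 : ℝ)..t, heatSγ N γ (t - σ) (fun y => U σ y ^ q) x := by
  have hq2 : 0 < 1 - q := by linarith
  have hη := eta₀_pos N hq1 h0
  set η := eta₀ N q γ with hηdef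
  set A := ((1 - q) * η) ^ (1 / (1 - q)) with hA
  have hA0 : 0 < A := by positivity
  have hAq : A ^ q * ((1 - q) * η) = A := by
    have e : (1 - q) * η = A ^ (1 - q) := by
      rw [hA, ← Real.rpow_mul (by positivity), one_div_mul_cancel hq2.ne', Real.rpow_one]
    rw [e, ← Real.rpow_add hA0, add_sub_cancel, Real.rpow_one]
  set E := Real.exp (-((1 + q) / 2 * b) * ‖x‖ ^ 2) with hE
  set P := (‖x‖ + √t) ^ (-γ / (1 - q)) with hP
  set D := θ ^ q * A ^ q * P * E * (κ * η) with hD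
  have hpow : (q / (1 - q)) + 1 = 1 / (1 - q) := by field_simp; ring
  have hr : -1 < q / (1 - q) := by
    have : 0 < q / (1 - q) := by positivity
    linarith
  have hI : ∫ σ in (0 : ℝ)..t, D * σ ^ (q / (1 - q)) = D * ((1 - q) * t ^ (1 / (1 - q))) := by
    rw [intervalIntegral.integral_const_mul, integral_rpow (Or.inl hr), hpow,
      Real.zero_rpow (by positivity)]
    field_simp
    ring
  have hlhs : θ ^ q * κ * lowerBound N q γ x t * E = D * ((1 - q) * t ^ (1 / (1 - q))) := by
    rw [lowerBound, ← hηdef, ← hA, ← hP, hD]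
    nth_rewrite 1 [← hAq]
    ring
  rw [hlhs, ← hI]
  refine intervalIntegral.integral_mono_on_of_le_Ioo ht.le
    ((intervalIntegral.intervalIntegrable_rpow' hr).const_mul D)
    (intervalIntegrable_heatSγ_rpow hN hq0 h0 hγ hU hU0 ht.le x) fun σ hσ => ?_
  obtain ⟨M, hM⟩ := exists_forall_abs_apply_le hU t
  have hσ0 := hσ.1
  have hstep := le_heatSγ_of_le hN hq0 hq1 h0 (hγ.trans_le (min_le_right _ _)) hσ.1 hσ.2
    (B := θ * A * σ ^ (1 / (1 - q))) (by positivity) hb (map_continuous (U σ))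
    (hM σ hσ.1.le hσ.2.le) (fun y => by
      have := h σ hσ.1 hσ.2 y
      rw [lowerBound, ← hηdef, ← hA] at this
      convert this using 2
      ring) x
  refine le_trans ?_ hstep
  rw [Real.mul_rpow (by positivity) (by positivity), Real.mul_rpow hθ hA0.le,
    ← Real.rpow_mul hσ0.le, one_div_mul_eq_div, ← hP, ← hE, hD]
  calc _ = θ ^ q * A ^ q * σ ^ (q / (1 - q)) * P * E * (κ * η) := by ring
    _ ≤ _ := by gcongr

/-! ### Comparison with the self-similar lower bound -/

lemma lowerBound_nonneg (N : ℕ) {q γ : ℝ} (hq1 : q < 1) (h0 : 0 ≤ γ) (x : RN N) {t : ℝ}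
    (ht : 0 ≤ t) : 0 ≤ lowerBound N q γ x t := by
  have := eta₀_pos N hq1 h0
  have h2 : 0 < 1 - q := by linarith
  unfold lowerBound
  positivity

/-- Iterating the Duhamel lower bound: the prefactors follow `θ ↦ κ θ^q`, whose fixed point is
`κ^{1/(1-q)}`, while the Gaussian damping disappears in the limit. -/
lemma rpow_mul_lowerBound_le_of_mul_exp_le {N : ℕ} (hN : 1 ≤ N) {q γ : ℝ} (hq0 : 0 < q)
    (hq1 : q < 1) (h0 : 0 ≤ γ) (hγ : γ < min 2 (N : ℝ)) {U : ℝ → C₀(RN N, ℝ)}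
    (hU : ContinuousOn U (Ici 0)) (hU0 : ∀ t, 0 ≤ t → ∀ x, 0 ≤ U t x)
    (hsup : ∀ t, 0 ≤ t → ∀ x,
      ∫ σ in (0 : ℝ)..t, heatSγ N γ (t - σ) (fun y => U σ y ^ q) x ≤ U t x)
    {T θ κ b : ℝ} (hθ : 0 < θ) (hκ0 : 0 < κ) (hb : 0 ≤ b)
    (hκ : κ * eta₀ N q γ ≤ weightedEta N q γ (q * (1 + q) / (1 - q) * b * T))
    (h : ∀ t, 0 < t → t ≤ T → ∀ x,
      θ * lowerBound N q γ x t * Real.exp (-b * ‖x‖ ^ 2) ≤ U t x) :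
    ∀ t, 0 < t → t ≤ T → ∀ x, κ ^ (1 / (1 - q)) * lowerBound N q γ x t ≤ U t x := by
  have hq2 : 0 < 1 - q := by linarith
  set k := κ ^ (1 / (1 - q)) with hk
  have hk0 : 0 < k := by positivity
  have hkq : k ^ q * κ = k := by
    have e : κ = k ^ (1 - q) := by
      rw [hk, ← Real.rpow_mul hκ0.le, one_div_mul_cancel hq2.ne', Real.rpow_one]
    calc k ^ q * κ = k ^ q * k ^ (1 - q) := congrArg _ e
      _ = k := by rw [← Real.rpow_add hk0, add_sub_cancel, Real.rpow_one]
  clear_value k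
  -- Starting from `k * (θ / k)`, the `n`-th prefactor is `k * (θ / k) ^ (q ^ n)`.
  have hiter : ∀ n : ℕ, ∀ t, 0 < t → t ≤ T → ∀ x,
      k * (θ / k) ^ (q ^ n) * lowerBound N q γ x t *
        Real.exp (-(((1 + q) / 2) ^ n * b) * ‖x‖ ^ 2) ≤ U t x := by
    intro n
    induction n with
    | zero =>
      intro t ht htT x
      simpa [mul_div_cancel₀ _ hk0.ne'] using h t ht htT x
    | succ n ih =>
      intro t ht htT x
      refine le_trans (le_of_eq ?_) ((mul_lowerBound_le_integral_heatSγ hN hq0 hq1 h0 hγ hU hU0 ht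
        (θ := k * (θ / k) ^ (q ^ n)) (κ := κ) (b := ((1 + q) / 2) ^ n * b) (by positivity)
        (by positivity) ?_ (fun σ hσ hσt => ih σ hσ (hσt.le.trans htT)) x).trans (hsup t ht.le x))
      · rw [Real.mul_rpow hk0.le (by positivity), ← Real.rpow_mul (by positivity), ← pow_succ,
          mul_right_comm (k ^ q), hkq, pow_succ']
        congr 3
        ring
      · refine hκ.trans (weightedEta_anti hq1 h0 (by positivity) ?_)
        have : ((1 + q) / 2) ^ n ≤ 1 := pow_le_one₀ (by linarith) (by linarith)
        have : ((1 + q) / 2) ^ n * b ≤ b := mul_le_of_le_one_left hb this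
        gcongr
  intro t ht htT x
  have l1 : Tendsto (fun n : ℕ => (θ / k) ^ (q ^ n)) atTop (𝓝 1) := by
    have h1 := (Real.continuousAt_const_rpow (a := θ / k) (b := 0) (by positivity)).tendsto.comp
      (tendsto_pow_atTop_nhds_zero_of_lt_one hq0.le hq1)
    simpa [Function.comp_def] using h1
  have l2 : Tendsto (fun n : ℕ => Real.exp (-(((1 + q) / 2) ^ n * b) * ‖x‖ ^ 2)) atTop (𝓝 1) := by
    have e := tendsto_pow_atTop_nhds_zero_of_lt_one (r := (1 + q) / 2) (by linarith) (by linarith)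
    have := (((e.mul_const b).neg).mul_const (‖x‖ ^ 2)).rexp
    simpa using this
  have l3 := (((l1.const_mul k).mul_const (lowerBound N q γ x t)).mul l2)
  simp only [mul_one] at l3
  exact le_of_tendsto' l3 fun n => hiter n t ht htT x

/-- A supersolution of the integral equation with zero datum that lies above a Gaussian on
`[0, T]` lies above `lowerBound` there. -/
lemma lowerBound_le_of_exp_le {N : ℕ} (hN : 1 ≤ N) {q γ : ℝ} (hq0 : 0 < q)
    (hq1 : q < 1) (h0 : 0 ≤ γ) (hγ : γ < min 2 (N : ℝ)) {U : ℝ → C₀(RN N, ℝ)}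
    (hU : ContinuousOn U (Ici 0)) (hU0 : ∀ t, 0 ≤ t → ∀ x, 0 ≤ U t x)
    (hsup : ∀ t, 0 ≤ t → ∀ x,
      ∫ σ in (0 : ℝ)..t, heatSγ N γ (t - σ) (fun y => U σ y ^ q) x ≤ U t x)
    {T θ b : ℝ} (hT : 0 < T) (hθ : 0 < θ) (hb : 0 ≤ b)
    (h : ∀ t, 0 < t → t ≤ T → ∀ x,
      θ * lowerBound N q γ x t * Real.exp (-b * ‖x‖ ^ 2) ≤ U t x) :
    ∀ t, 0 < t → t ≤ T → ∀ x, lowerBound N q γ x t ≤ U t x := by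
  have hq2 : 0 < 1 - q := by linarith
  have hη := eta₀_pos N hq1 h0
  set κ := weightedEta N q γ (q * (1 + q) / (1 - q) * b * T) / eta₀ N q γ with hκ
  have hκ0 : 0 < κ := div_pos (weightedEta_pos hq1 h0 (by positivity)) hη
  have h1 := rpow_mul_lowerBound_le_of_mul_exp_le hN hq0 hq1 h0 hγ hU hU0 hsup hθ hκ0 hb
    (div_mul_cancel₀ _ hη.ne').le h
  -- Without Gaussian damping the iteration loses nothing, so its fixed point is `1`.
  have h2 := rpow_mul_lowerBound_le_of_mul_exp_le hN hq0 hq1 h0 hγ hU hU0 hsup (T := T)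
    (θ := κ ^ (1 / (1 - q))) (κ := 1) (b := 0) (by positivity) one_pos le_rfl
    (by simp [weightedEta_zero]) (by simpa using h1)
  simpa using h2

/-- Translates in time of a nonnegative solution are supersolutions with zero datum. -/
lemma IsNonnegSolution.integral_translate_le {N : ℕ} (hN : 1 ≤ N) {q γ : ℝ} (hq0 : 0 < q)
    (h0 : 0 ≤ γ) (hγ : γ < min 2 (N : ℝ)) {u₀ : C₀(RN N, ℝ)} {u : ℝ → C₀(RN N, ℝ)}
    (hu : IsNonnegSolution N q γ u₀ u) (hu₀ : ∀ x, 0 ≤ u₀ x) {τ t : ℝ} (hτ : 0 ≤ τ) (ht : 0 ≤ t)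
    (x : RN N) :
    ∫ σ in (0 : ℝ)..t, heatSγ N γ (t - σ) (fun y => u (σ + τ) y ^ q) x ≤ u (t + τ) x := by
  have hint := intervalIntegrable_heatSγ_rpow hN hq0 h0 hγ hu.continuousOn hu.nonneg
    (add_nonneg ht hτ) x
  rw [hu.eq_duhamel _ (add_nonneg ht hτ), duhamel]
  have h1 := heatS_nonneg (add_nonneg ht hτ) hu₀ x
  have h2 := intervalIntegral.integral_comp_add_right (a := 0) (b := t)
    (fun σ => heatSγ N γ (t + τ - σ) (fun y => u σ y ^ q) x) τ
  simp only [add_sub_add_right_eq_sub, zero_add] at h2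
  rw [h2]
  have i1 : IntervalIntegrable (fun σ => heatSγ N γ (t + τ - σ) (fun y => u σ y ^ q) x)
      volume 0 τ := hint.mono_set (by
    rw [uIcc_of_le hτ, uIcc_of_le (add_nonneg ht hτ)]; exact Icc_subset_Icc_right (by linarith))
  have i2 : IntervalIntegrable (fun σ => heatSγ N γ (t + τ - σ) (fun y => u σ y ^ q) x)
      volume τ (t + τ) := hint.mono_set (by
    rw [uIcc_of_le (by linarith), uIcc_of_le (add_nonneg ht hτ)]; exact Icc_subset_Icc_left hτ)
  rw [← intervalIntegral.integral_add_adjacent_intervals i1 i2]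
  have h3 : 0 ≤ ∫ σ in (0 : ℝ)..τ, heatSγ N γ (t + τ - σ) (fun y => u σ y ^ q) x := by
    rw [intervalIntegral.integral_of_le hτ, integral_Ioc_eq_integral_Ioo]
    refine setIntegral_nonneg measurableSet_Ioo fun σ hσ => ?_
    refine heatSγ_nonneg ?_ (fun y => Real.rpow_nonneg (hu.nonneg σ hσ.1.le y) q) x
    linarith [hσ.2]
  linarith

lemma lowerBound_le_rpow {N : ℕ} {q γ : ℝ} (hq1 : q < 1) (h0 : 0 ≤ γ) (x : RN N) {t : ℝ}
    (ht : 0 < t) :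
    lowerBound N q γ x t ≤
      ((1 - q) * eta₀ N q γ) ^ (1 / (1 - q)) * t ^ ((1 - γ / 2) / (1 - q)) := by
  have := eta₀_pos N hq1 h0
  have h2 : 0 < 1 - q := by linarith
  have hs : 0 < √t := by positivity
  have h3 : (‖x‖ + √t) ^ (-γ / (1 - q)) ≤ √t ^ (-γ / (1 - q)) :=
    Real.rpow_le_rpow_of_nonpos hs (by have := norm_nonneg x; linarith)
      (neg_div_one_sub_nonpos hq1 h0)
  have h4 : t ^ (1 / (1 - q)) * √t ^ (-γ / (1 - q)) = t ^ ((1 - γ / 2) / (1 - q)) := by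
    rw [Real.sqrt_eq_rpow, ← Real.rpow_mul ht.le, ← Real.rpow_add ht]
    ring_nf
  rw [lowerBound, mul_assoc, ← h4]
  gcongr

lemma IsNonnegSolution.lowerBound_le {N : ℕ} (hN : 1 ≤ N) {q γ : ℝ} (hq0 : 0 < q) (hq1 : q < 1)
    (h0 : 0 ≤ γ) (hγ : γ < min 2 (N : ℝ)) {u₀ : C₀(RN N, ℝ)} {u : ℝ → C₀(RN N, ℝ)}
    (hu : IsNonnegSolution N q γ u₀ u) (hu₀ : ∀ x, 0 ≤ u₀ x) (hne : u₀ ≠ 0) {t : ℝ} (ht : 0 ≤ t)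
    (x : RN N) : lowerBound N q γ x t ≤ u t x := by
  have hq2 : 0 < 1 - q := by linarith
  have hγ2 : γ < 2 := hγ.trans_le (min_le_left _ _)
  rcases ht.eq_or_lt with rfl | ht
  · rw [lowerBound, Real.zero_rpow (by positivity), mul_zero, zero_mul]
    exact hu.nonneg 0 le_rfl x
  have hη := eta₀_pos N hq1 h0
  set A := ((1 - q) * eta₀ N q γ) ^ (1 / (1 - q)) with hA
  have hA0 : 0 < A := by positivity
  -- After a time shift `τ > 0` the solution dominates a Gaussian; then let `τ → 0`.
  have hshift : ∀ τ, 0 < τ → lowerBound N q γ x t ≤ u (t + τ) x := by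
    intro τ hτ
    obtain ⟨c, hc, hcle⟩ := exists_mul_exp_le_heatS hu₀ hne hτ (by linarith : τ ≤ t + τ)
    set L := A * t ^ ((1 - γ / 2) / (1 - q)) with hL
    have hL0 : 0 < L := by positivity
    refine lowerBound_le_of_exp_le hN hq0 hq1 h0 hγ (U := fun s => u (s + τ)) (T := t)
      (θ := c / L) (b := 1 / (2 * τ)) ?_ (fun s hs y => hu.nonneg _ (by linarith) y)
      (fun s hs y => hu.integral_translate_le hN hq0 h0 hγ hu₀ hτ.le hs y) ht (by positivity)
      (by positivity) (fun s hs hst y => ?_) t ht le_rfl x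
    · exact hu.continuousOn.comp (by fun_prop) fun s hs => by
        have : (0 : ℝ) ≤ s := hs
        show (0 : ℝ) ≤ s + τ
        linarith
    · have e1 : lowerBound N q γ y s ≤ L := by
        refine (lowerBound_le_rpow hq1 h0 y hs).trans ?_
        rw [hL]
        gcongr
        exact div_nonneg (by linarith) hq2.le
      have e2 : c / L * lowerBound N q γ y s ≤ c := by
        calc _ ≤ c / L * L := by gcongr
          _ = c := div_mul_cancel₀ _ hL0.ne'
      rw [hu.eq_duhamel _ (by linarith)]
      refine le_trans ?_ (heatS_le_duhamel u₀ hu.nonneg (by linarith) y)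
      refine le_trans ?_ (hcle (s + τ) (by linarith) (by linarith) y)
      gcongr
  have hcont : ContinuousWithinAt (fun τ => u (t + τ) x) (Ioi 0) 0 := by
    have h1 : ContinuousOn (fun s => u s x) (Ici 0) := by
      have := (continuousOn_uncurry_of_continuousOn hu.continuousOn).comp
        (f := fun s : ℝ => (s, x)) (s := Ici 0) (by fun_prop) (fun s hs => ⟨hs, mem_univ _⟩)
      exact this
    have h2 : ContinuousAt (fun s => u s x) (t + 0) :=
      (h1 (t + 0) (by simpa using ht.le)).continuousAt (by simpa using Ici_mem_nhds ht)
    exact (ContinuousAt.comp (f := fun τ => t + τ) (x := (0 : ℝ)) h2 (by fun_prop)).continuousWithinAt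
  have hlim : Tendsto (fun τ => u (t + τ) x) (𝓝[>] 0) (𝓝 (u t x)) := by
    simpa using hcont.tendsto
  exact ge_of_tendsto hlim (eventually_mem_nhdsWithin.mono fun τ hτ => hshift τ hτ)

/-! ### The self-similar subsolution as a curve in `C₀(ℝ^N)` -/

lemma exists_zeroAtInfty_eq_lowerBound (N : ℕ) {q γ : ℝ} (hq1 : q < 1) (h0 : 0 < γ) {t : ℝ}
    (ht : 0 ≤ t) : ∃ f : C₀(RN N, ℝ), ∀ x, f x = lowerBound N q γ x t := by
  have hq2 : 0 < 1 - q := by linarith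
  rcases ht.eq_or_lt with rfl | ht
  · refine ⟨0, fun x => ?_⟩
    rw [lowerBound, Real.zero_rpow (by positivity), mul_zero, zero_mul]
    rfl
  have hs : 0 < √t := by positivity
  refine ⟨⟨⟨fun x => lowerBound N q γ x t, ?_⟩, ?_⟩, fun x => rfl⟩
  · refine continuous_const.mul ?_
    exact (continuous_norm.add continuous_const).rpow_const fun x =>
      Or.inl (add_pos_of_nonneg_of_pos (norm_nonneg x) hs).ne'
  · have h1 : Tendsto (fun x : RN N => ‖x‖ + √t) (cocompact _) atTop :=
      tendsto_atTop_add_const_right _ _ (tendsto_norm_cocompact_atTop)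
    have h2 := (tendsto_rpow_neg_atTop (y := γ / (1 - q)) (by positivity)).comp h1
    have h3 := h2.const_mul (((1 - q) * eta₀ N q γ) ^ (1 / (1 - q)) * t ^ (1 / (1 - q)))
    rw [mul_zero] at h3
    refine h3.congr fun x => ?_
    simp only [Function.comp_apply, lowerBound, neg_div]

lemma abs_rpow_sub_rpow_le_of_nonpos {p m a b : ℝ} (hp : p ≤ 0) (hm : 0 < m) (ha : m ≤ a)
    (hb : m ≤ b) : |a ^ p - b ^ p| ≤ |p| * m ^ (p - 1) * |a - b| := by
  have h := Convex.norm_image_sub_le_of_norm_hasDerivWithin_le (f := fun s : ℝ => s ^ p)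
    (f' := fun s => p * s ^ (p - 1)) (s := Ici m) (C := |p| * m ^ (p - 1)) (x := b) (y := a)
    (fun s hs => (Real.hasDerivAt_rpow_const
      (Or.inl (hm.trans_le hs).ne')).hasDerivWithinAt) (fun s hs => ?_) (convex_Ici m) hb ha
  · exact h
  · have hs0 : 0 < s := hm.trans_le hs
    rw [norm_mul, Real.norm_eq_abs, Real.norm_of_nonneg (by positivity)]
    gcongr ?_ * ?_
    exact Real.rpow_le_rpow_of_nonpos hm hs (by linarith)

/-- Continuity in the sup norm at `t > 0` comes from the Lipschitz bound for
`s ↦ s^{-γ/(1-q)}` on a half-line away from `0`; at `t = 0` it comes from the decay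
`O(t^{(1-γ/2)/(1-q)})`. -/
lemma exists_continuousOn_eq_lowerBound (N : ℕ) {q γ : ℝ} (hq1 : q < 1) (h0 : 0 < γ)
    (hγ : γ < 2) :
    ∃ w : ℝ → C₀(RN N, ℝ), (∀ t, 0 ≤ t → ∀ x, w t x = lowerBound N q γ x t) ∧
      ContinuousOn w (Ici 0) := by
  have hq2 : 0 < 1 - q := by linarith
  have hη := eta₀_pos N hq1 h0.le
  have hex : ∀ t : ℝ, ∃ f : C₀(RN N, ℝ), 0 ≤ t → ∀ x, f x = lowerBound N q γ x t := fun t => by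
    by_cases ht : 0 ≤ t
    · obtain ⟨f, hf⟩ := exists_zeroAtInfty_eq_lowerBound N hq1 h0 ht
      exact ⟨f, fun _ => hf⟩
    · exact ⟨0, fun h => absurd h ht⟩
  choose w hw using hex
  refine ⟨w, hw, fun t ht => ?_⟩
  set A := ((1 - q) * eta₀ N q γ) ^ (1 / (1 - q)) with hA
  have hA0 : 0 < A := by positivity
  have ht' : (0 : ℝ) ≤ t := ht
  rcases ht'.eq_or_lt with rfl | htpos
  · have hw0 : w 0 = 0 := ZeroAtInftyContinuousMap.ext fun x => by
      rw [hw 0 le_rfl, lowerBound, Real.zero_rpow (by positivity), mul_zero, zero_mul]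
      rfl
    have hα : 0 < (1 - γ / 2) / (1 - q) := div_pos (by linarith) hq2
    rw [ContinuousWithinAt, hw0]
    have hlim : Tendsto (fun s : ℝ => A * s ^ ((1 - γ / 2) / (1 - q))) (𝓝[≥] 0) (𝓝 0) := by
      have h1 := ((Real.continuousAt_rpow_const 0 _ (Or.inr hα.le)).const_mul A).tendsto
      rw [Real.zero_rpow hα.ne', mul_zero] at h1
      exact h1.mono_left nhdsWithin_le_nhds
    refine squeeze_zero_norm' (eventually_mem_nhdsWithin.mono fun s hs => ?_) hlim
    have hs0 : (0 : ℝ) ≤ s := hs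
    refine ZeroAtInftyContinuousMap.norm_le_of_abs_le (by positivity) fun x => ?_
    rw [hw s hs0, abs_of_nonneg (lowerBound_nonneg N hq1 h0.le x hs0)]
    rcases hs0.eq_or_lt with rfl | hspos
    · rw [lowerBound, Real.zero_rpow (by positivity), Real.zero_rpow hα.ne', mul_zero, zero_mul]
    · exact lowerBound_le_rpow hq1 h0.le x hspos
  · refine ContinuousAt.continuousWithinAt ?_
    rw [ContinuousAt, tendsto_iff_norm_sub_tendsto_zero]
    set p := -γ / (1 - q) with hp
    have hp0 : p ≤ 0 := neg_div_one_sub_nonpos hq1 h0.le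
    set m := √(t / 2) with hm
    have hm0 : 0 < m := by positivity
    set a : ℝ → ℝ := fun s => A * s ^ (1 / (1 - q)) with ha
    have hac : ContinuousAt a t :=
      (Real.continuousAt_rpow_const t _ (Or.inl htpos.ne')).const_mul A
    have ha0 : 0 ≤ a t := by positivity
    have hlim : Tendsto (fun s => |a s - a t| * m ^ p + a t * (|p| * m ^ (p - 1) * |√s - √t|))
        (𝓝 t) (𝓝 0) := by
      have h1 : Tendsto (fun s => |a s - a t|) (𝓝 t) (𝓝 0) := by
        have := (hac.tendsto.sub_const (a t)).abs
        simpa using this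
      have h2 : Tendsto (fun s => |√s - √t|) (𝓝 t) (𝓝 0) := by
        have := ((Real.continuous_sqrt.tendsto t).sub_const (√t)).abs
        simpa using this
      have := (h1.mul_const (m ^ p)).add ((h2.const_mul (|p| * m ^ (p - 1))).const_mul (a t))
      simpa using this
    refine squeeze_zero' (Eventually.of_forall fun _ => norm_nonneg _) ?_ hlim
    filter_upwards [lt_mem_nhds (half_lt_self htpos)] with s hs
    have hs0 : 0 < s := by linarith
    refine ZeroAtInftyContinuousMap.norm_le_of_abs_le (by positivity) fun x => ?_
    have hx := norm_nonneg x
    have e : (w s - w t) x = (a s - a t) * (‖x‖ + √s) ^ p +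
        a t * ((‖x‖ + √s) ^ p - (‖x‖ + √t) ^ p) := by
      rw [ZeroAtInftyContinuousMap.sub_apply, hw s hs0.le, hw t ht', lowerBound, lowerBound]
      dsimp only [a]
      ring
    have e1 : m ≤ ‖x‖ + √s := by
      have : m ≤ √s := Real.sqrt_le_sqrt hs.le
      linarith
    have e2 : m ≤ ‖x‖ + √t := by
      have : m ≤ √t := Real.sqrt_le_sqrt (half_le_self ht')
      linarith
    rw [e]
    refine (abs_add_le _ _).trans ?_
    rw [abs_mul, abs_mul, abs_of_nonneg ha0, abs_of_nonneg (by positivity : 0 ≤ (‖x‖ + √s) ^ p)]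
    refine add_le_add (mul_le_mul_of_nonneg_left ?_ (abs_nonneg _))
      (mul_le_mul_of_nonneg_left ?_ ha0)
    · exact Real.rpow_le_rpow_of_nonpos hm0 e1 hp0
    · have := abs_rpow_sub_rpow_le_of_nonpos hp0 hm0 e1 e2
      rwa [add_sub_add_left_eq_sub] at this

lemma exists_isNonnegSubsolution_eq_lowerBound {N : ℕ} (hN : 1 ≤ N) {q γ : ℝ} (hq0 : 0 < q)
    (hq1 : q < 1) (h0 : 0 < γ) (hγ : γ < min 2 (N : ℝ)) :
    ∃ w : ℝ → C₀(RN N, ℝ), (∀ t, 0 ≤ t → ∀ x, w t x = lowerBound N q γ x t) ∧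
      IsNonnegSubsolution N q γ 0 w := by
  obtain ⟨w, hw, hwc⟩ := exists_continuousOn_eq_lowerBound N hq1 h0 (hγ.trans_le (min_le_left _ _))
  have hw0 : ∀ t, 0 ≤ t → ∀ x, 0 ≤ w t x := fun t ht x => by
    rw [hw t ht]
    exact lowerBound_nonneg N hq1 h0.le x ht
  refine ⟨w, hw, hwc, hw0, fun t ht x => ?_⟩
  rcases ht.eq_or_lt with rfl | htpos
  · refine le_trans (le_of_eq ?_) (heatS_le_duhamel 0 hw0 le_rfl x)
    rw [hw 0 le_rfl, lowerBound, Real.zero_rpow (one_div_pos.2 (by linarith)).ne', mul_zero,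
      zero_mul]
    simp [heatS]
  · have h := mul_lowerBound_le_integral_heatSγ hN hq0 hq1 h0.le hγ hwc hw0 htpos (θ := 1) (κ := 1)
      (b := 0) zero_le_one le_rfl (by simp [weightedEta_zero])
      (fun σ hσ _ y => by simp [hw σ hσ.le]) x
    simp only [Real.one_rpow, one_mul, mul_zero, neg_zero, zero_mul, Real.exp_zero, mul_one] at h
    rw [hw t ht, duhamel]
    have := heatS_nonneg ht (φ := (0 : C₀(RN N, ℝ))) (fun _ => le_rfl) x
    linarith

/-! ### The difference of two solutions -/

lemma abs_rpow_sub_rpow_le {a b q : ℝ} (ha : 0 ≤ a) (hb : 0 ≤ b) (hq0 : 0 < q) (hq1 : q < 1) :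
    |a ^ q - b ^ q| ≤ |a - b| ^ q := by
  wlog hab : b ≤ a generalizing a b
  · rw [abs_sub_comm, abs_sub_comm a b]
    exact this hb ha (le_of_not_ge hab)
  have h1 : b ^ q ≤ a ^ q := by gcongr
  rw [abs_of_nonneg (sub_nonneg.2 h1), abs_of_nonneg (sub_nonneg.2 hab)]
  have h2 := NNReal.rpow_add_le_add_rpow ⟨b, hb⟩ ⟨a - b, sub_nonneg.2 hab⟩ hq0.le hq1.le
  have h3 : (b + (a - b)) ^ q ≤ b ^ q + (a - b) ^ q := by exact_mod_cast h2
  rw [add_sub_cancel] at h3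
  linarith

/-- Concavity: away from `0` the power `s ↦ s^q` is Lipschitz. -/
lemma abs_rpow_sub_rpow_le_mul {a b m q : ℝ} (hm : 0 < m) (ha : m ≤ a) (hb : m ≤ b) (hq0 : 0 < q)
    (hq1 : q < 1) : |a ^ q - b ^ q| ≤ q * m ^ (q - 1) * |a - b| := by
  wlog hab : b ≤ a generalizing a b
  · rw [abs_sub_comm, abs_sub_comm a b]
    exact this hb ha (le_of_not_ge hab)
  have hb0 : 0 < b := hm.trans_le hb
  have ha0 : 0 < a := hm.trans_le ha
  have h1 : b ^ q ≤ a ^ q := by gcongr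
  rw [abs_of_nonneg (sub_nonneg.2 h1), abs_of_nonneg (sub_nonneg.2 hab)]
  have h2 := rpow_one_add_le_one_add_mul_self (s := (a - b) / b) (by
    have : 0 ≤ (a - b) / b := div_nonneg (sub_nonneg.2 hab) hb0.le
    linarith) hq0.le hq1.le
  have h3 : a = b * (1 + (a - b) / b) := by field_simp; ring
  have h4 : a ^ q ≤ b ^ q * (1 + q * ((a - b) / b)) := by
    nth_rewrite 1 [h3]
    rw [Real.mul_rpow hb0.le (by
      have : 0 ≤ (a - b) / b := div_nonneg (sub_nonneg.2 hab) hb0.le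
      linarith)]
    gcongr
  have h5 : b ^ q * (1 + q * ((a - b) / b)) = b ^ q + q * b ^ (q - 1) * (a - b) := by
    rw [Real.rpow_sub_one hb0.ne']; field_simp
  have h6 : b ^ (q - 1) ≤ m ^ (q - 1) := Real.rpow_le_rpow_of_nonpos hm hb (by linarith)
  have h7 : q * b ^ (q - 1) * (a - b) ≤ q * m ^ (q - 1) * (a - b) := by
    have := sub_nonneg.2 hab
    gcongr
  linarith

lemma heatSγ_sub {N : ℕ} (hN : 1 ≤ N) {γ : ℝ} (h0 : 0 ≤ γ) (hγ : γ < N) {t M : ℝ} (ht : 0 < t)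
    (x : RN N) {φ ψ : RN N → ℝ} (hφ : Continuous φ) (hψ : Continuous ψ) (hφM : ∀ y, |φ y| ≤ M)
    (hψM : ∀ y, |ψ y| ≤ M) :
    heatSγ N γ t φ x - heatSγ N γ t ψ x = heatSγ N γ t (fun y => φ y - ψ y) x := by
  rw [heatSγ, heatSγ, heatSγ,
    ← integral_sub (integrable_heatSγ_integrand hN h0 hγ ht x hφ.aestronglyMeasurable hφM)
      (integrable_heatSγ_integrand hN h0 hγ ht x hψ.aestronglyMeasurable hψM)]
  congr 1
  ext y
  ring

lemma IsNonnegSolution.abs_sub_le_integral {N : ℕ} (hN : 1 ≤ N) {q γ : ℝ} (hq0 : 0 < q)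
    (h0 : 0 ≤ γ) (hγ : γ < min 2 (N : ℝ)) {u₀ : C₀(RN N, ℝ)} {u v : ℝ → C₀(RN N, ℝ)}
    (hu : IsNonnegSolution N q γ u₀ u) (hv : IsNonnegSolution N q γ u₀ v) {t : ℝ} (ht : 0 ≤ t)
    (x : RN N) {g : ℝ → ℝ} (hg : IntervalIntegrable g volume 0 t)
    (h : ∀ σ, 0 < σ → σ < t → |heatSγ N γ (t - σ) (fun y => u σ y ^ q - v σ y ^ q) x| ≤ g σ) :
    |u t x - v t x| ≤ ∫ σ in (0 : ℝ)..t, g σ := by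
  rw [hu.eq_duhamel t ht, hv.eq_duhamel t ht, duhamel, duhamel, add_sub_add_left_eq_sub,
    ← intervalIntegral.integral_sub
      (intervalIntegrable_heatSγ_rpow hN hq0 h0 hγ hu.continuousOn hu.nonneg ht x)
      (intervalIntegrable_heatSγ_rpow hN hq0 h0 hγ hv.continuousOn hv.nonneg ht x)]
  rw [intervalIntegral.integral_of_le ht, intervalIntegral.integral_of_le ht,
    integral_Ioc_eq_integral_Ioo, integral_Ioc_eq_integral_Ioo, ← Real.norm_eq_abs]
  rw [intervalIntegrable_iff_integrableOn_Ioo_of_le ht] at hg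
  refine norm_integral_le_of_norm_le hg
    ((ae_restrict_iff' measurableSet_Ioo).2 (ae_of_all _ fun σ hσ => ?_))
  obtain ⟨M₁, hM₁⟩ := exists_forall_abs_apply_le hu.continuousOn t
  obtain ⟨M₂, hM₂⟩ := exists_forall_abs_apply_le hv.continuousOn t
  rw [heatSγ_sub hN h0 (hγ.trans_le (min_le_right _ _)) (sub_pos.2 hσ.2) x
    (M := max (M₁ ^ q) (M₂ ^ q))
    ((map_continuous (u σ)).rpow_const fun _ => Or.inr hq0.le)
    ((map_continuous (v σ)).rpow_const fun _ => Or.inr hq0.le)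
    (fun y => le_max_of_le_left
      (abs_rpow_le_rpow hq0.le (hu.nonneg σ hσ.1.le y) (hM₁ σ hσ.1.le hσ.2.le y)))
    (fun y => le_max_of_le_right
      (abs_rpow_le_rpow hq0.le (hv.nonneg σ hσ.1.le y) (hM₂ σ hσ.1.le hσ.2.le y)))]
  exact h σ hσ.1 hσ.2

/-- Two solutions with the same datum differ by at most `O(t^α)`, where `α = (1 - γ/2) / (1 - q)`
is the growth rate of the maximal solution of `z(t) ≤ C ∫ (t-σ)^{-γ/2} z(σ)^q dσ`. -/
lemma IsNonnegSolution.exists_abs_sub_le {N : ℕ} (hN : 1 ≤ N) {q γ : ℝ} (hq0 : 0 < q) (hq1 : q < 1)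
    (h0 : 0 ≤ γ) (hγ : γ < min 2 (N : ℝ)) {u₀ : C₀(RN N, ℝ)} {u v : ℝ → C₀(RN N, ℝ)}
    (hu : IsNonnegSolution N q γ u₀ u) (hv : IsNonnegSolution N q γ u₀ v) :
    ∃ L : ℝ, 0 ≤ L ∧ ∀ t, 0 ≤ t → ∀ x, |u t x - v t x| ≤ L * t ^ ((1 - γ / 2) / (1 - q)) := by
  obtain ⟨C, hC0, hC⟩ := exists_integral_heatKernel_mul_norm_rpow_le hN h0
    (hγ.trans_le (min_le_right _ _))
  have hγ2 : γ < 2 := hγ.trans_le (min_le_left _ _)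
  have hq2 : 0 < 1 - q := by linarith
  have hγ3 : 0 < 1 - γ / 2 := by linarith
  refine ⟨(C / (1 - γ / 2)) ^ (1 / (1 - q)), by positivity, fun t ht x => ?_⟩
  have hcont : ContinuousOn (fun s => ‖u s - v s‖) (Icc 0 t) :=
    ((hu.continuousOn.sub hv.continuousOn).norm).mono Icc_subset_Ici_self
  -- At a maximum point `s` of the norm on `[0, t]` the inequality for the norm closes up.
  obtain ⟨s, hs, hmax⟩ := isCompact_Icc.exists_isMaxOn ⟨0, left_mem_Icc.2 ht⟩ hcont
  set M := ‖u s - v s‖ with hM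
  have hM0 : 0 ≤ M := norm_nonneg _
  have hle : |u t x - v t x| ≤ M :=
    ((u t - v t).abs_apply_le_norm x).trans (hmax (right_mem_Icc.2 ht))
  refine hle.trans ?_
  have hkey : M ≤ C / (1 - γ / 2) * t ^ (1 - γ / 2) * M ^ q := by
    refine ZeroAtInftyContinuousMap.norm_le_of_abs_le (by positivity) fun y => ?_
    have h1 := hu.abs_sub_le_integral hN hq0 h0 hγ hv hs.1 y
      (g := fun σ => C * M ^ q * (s - σ) ^ (-(γ / 2)))
      ((intervalIntegrable_sub_rpow hγ2).const_mul _) (fun σ hσ0 hσs => ?_)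
    · rw [intervalIntegral.integral_const_mul, integral_sub_rpow hγ2] at h1
      refine h1.trans ?_
      have h2 : s ^ (1 - γ / 2) ≤ t ^ (1 - γ / 2) := Real.rpow_le_rpow hs.1 hs.2 hγ3.le
      calc _ = C / (1 - γ / 2) * s ^ (1 - γ / 2) * M ^ q := by ring
        _ ≤ _ := by gcongr
    · refine abs_heatSγ_le (sub_pos.2 hσs) y (hC _ (sub_pos.2 hσs) y) fun z => ?_
      refine (abs_rpow_sub_rpow_le (hu.nonneg σ hσ0.le z) (hv.nonneg σ hσ0.le z) hq0 hq1).trans ?_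
      have h2 : |u σ z - v σ z| ≤ M :=
        ((u σ - v σ).abs_apply_le_norm z).trans (hmax ⟨hσ0.le, hσs.le.trans hs.2⟩)
      gcongr
  rcases hM0.eq_or_lt with h | hMpos
  · rw [← h]; positivity
  have h1 : M ^ (1 - q) ≤ C / (1 - γ / 2) * t ^ (1 - γ / 2) := by
    rw [Real.rpow_sub hMpos, Real.rpow_one, div_le_iff₀ (by positivity)]
    exact hkey
  have h2 : (M ^ (1 - q)) ^ (1 / (1 - q)) ≤
      (C / (1 - γ / 2) * t ^ (1 - γ / 2)) ^ (1 / (1 - q)) := by gcongr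
  rw [← Real.rpow_mul hM0, mul_one_div_cancel hq2.ne', Real.rpow_one,
    Real.mul_rpow (by positivity) (by positivity), ← Real.rpow_mul ht, mul_one_div] at h2
  exact h2

/-- The constant stays close to `1` for small `γ`, and the singularity `r^{1/2}` in `r = √σ / |y|`
is integrable in every dimension. -/
lemma one_add_rpow_le {r γ : ℝ} (hr : 0 ≤ r) (h0 : 0 ≤ γ) (hγ : γ ≤ 1 / 2) :
    (1 + r) ^ γ ≤ 1 + 2 * γ * √r := by
  have h1 : 1 + r ≤ (1 + √r) ^ (2 : ℝ) := by
    rw [Real.rpow_two]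
    nlinarith [Real.sq_sqrt hr, Real.sqrt_nonneg r]
  calc (1 + r) ^ γ ≤ ((1 + √r) ^ (2 : ℝ)) ^ γ := by gcongr
    _ = (1 + √r) ^ (2 * γ) := by rw [← Real.rpow_mul (by positivity)]
    _ ≤ _ := rpow_one_add_le_one_add_mul_self (by linarith [Real.sqrt_nonneg r]) (by linarith)
      (by linarith)

lemma norm_rpow_mul_abs_sub_le {N : ℕ} {q γ : ℝ} (hq0 : 0 < q) (hq1 : q < 1)
    (h0 : 0 < γ) (hγ : γ ≤ 1 / 2) {σ a b : ℝ} (hσ : 0 < σ) (y : RN N)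
    (ha : lowerBound N q γ y σ ≤ a) (hb : lowerBound N q γ y σ ≤ b) :
    ‖y‖ ^ (-γ) * |a ^ q - b ^ q| ≤ q / ((1 - q) * eta₀ N q γ) * σ⁻¹ *
      (1 + 2 * γ * σ ^ (1 / 4 : ℝ) * ‖y‖ ^ (-(1 / 2) : ℝ)) * |a - b| := by
  have hη := eta₀_pos N hq1 h0.le
  have hq2 : 0 < 1 - q := by linarith
  rcases eq_or_ne y 0 with rfl | hy
  · rw [norm_zero, Real.zero_rpow (by linarith), zero_mul]
    positivity
  have hy0 : 0 < ‖y‖ := norm_pos_iff.2 hy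
  have hs : 0 < √σ := by positivity
  have hwpos : 0 < lowerBound N q γ y σ := by
    unfold lowerBound
    positivity
  have hw : lowerBound N q γ y σ ^ (q - 1) =
      ((1 - q) * eta₀ N q γ)⁻¹ * σ⁻¹ * (‖y‖ + √σ) ^ γ := by
    have e1 : 1 / (1 - q) * (q - 1) = -1 := by field_simp; ring
    have e2 : -γ / (1 - q) * (q - 1) = γ := by field_simp; ring
    rw [lowerBound, Real.mul_rpow (by positivity) (by positivity),
      Real.mul_rpow (by positivity) (by positivity), ← Real.rpow_mul (by positivity),
      ← Real.rpow_mul hσ.le, ← Real.rpow_mul (by positivity), e1, e2, Real.rpow_neg_one,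
      Real.rpow_neg_one]
  have h1 : ‖y‖ ^ (-γ) * (‖y‖ + √σ) ^ γ = (1 + √σ / ‖y‖) ^ γ := by
    have e : 1 + √σ / ‖y‖ = ‖y‖⁻¹ * (‖y‖ + √σ) := by field_simp
    rw [e, Real.mul_rpow (by positivity) (by positivity), Real.inv_rpow hy0.le,
      Real.rpow_neg hy0.le]
  have h2 : √(√σ / ‖y‖) = σ ^ (1 / 4 : ℝ) * ‖y‖ ^ (-(1 / 2) : ℝ) := by
    rw [Real.sqrt_div' _ hy0.le, Real.rpow_neg hy0.le, Real.sqrt_eq_rpow ‖y‖, div_eq_mul_inv,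
      Real.sqrt_eq_rpow (√σ), Real.sqrt_eq_rpow σ, ← Real.rpow_mul hσ.le]
    norm_num
  have h3 := one_add_rpow_le (r := √σ / ‖y‖) (by positivity) h0.le hγ
  rw [h2, ← mul_assoc] at h3
  have h4 := abs_rpow_sub_rpow_le_mul hwpos ha hb hq0 hq1
  calc _ ≤ ‖y‖ ^ (-γ) * (q * lowerBound N q γ y σ ^ (q - 1) * |a - b|) := by gcongr
    _ = q / ((1 - q) * eta₀ N q γ) * σ⁻¹ * (‖y‖ ^ (-γ) * (‖y‖ + √σ) ^ γ) * |a - b| := by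
      rw [hw]; ring
    _ ≤ _ := by
      rw [h1]
      gcongr

/-- Since both solutions lie above `lowerBound`, the bound `O(t^α)` on their difference
reproduces itself with a new constant, which is smaller when `γ` is small. -/
lemma IsNonnegSolution.abs_sub_le_of_abs_sub_le {N : ℕ} (hN : 1 ≤ N) {q γ : ℝ} (hq0 : 0 < q)
    (hq1 : q < 1) (h0 : 0 < γ) (hγ : γ ≤ 1 / 2) (hγN : γ < min 2 (N : ℝ)) {C : ℝ} (hC0 : 0 < C)
    (hC : ∀ t : ℝ, 0 < t → ∀ x : RN N,
      Integrable (fun y => heatKernel N t (x - y) * ‖y‖ ^ (-(1 / 2) : ℝ)) ∧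
      ∫ y, heatKernel N t (x - y) * ‖y‖ ^ (-(1 / 2) : ℝ) ≤ C * t ^ (-(1 / 2 / 2) : ℝ))
    {u₀ : C₀(RN N, ℝ)} (hu₀ : ∀ x, 0 ≤ u₀ x) (hne : u₀ ≠ 0) {u v : ℝ → C₀(RN N, ℝ)}
    (hu : IsNonnegSolution N q γ u₀ u) (hv : IsNonnegSolution N q γ u₀ v) {L : ℝ} (hL : 0 ≤ L)
    (h : ∀ t, 0 ≤ t → ∀ x, |u t x - v t x| ≤ L * t ^ ((1 - γ / 2) / (1 - q))) {t : ℝ} (ht : 0 ≤ t)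
    (x : RN N) :
    |u t x - v t x| ≤ q / ((1 - q) * eta₀ N q γ) *
      ((1 - q) / (1 - γ / 2) + 8 / 3 * γ * C) * L * t ^ ((1 - γ / 2) / (1 - q)) := by
  have hη := eta₀_pos N hq1 h0.le
  have hq2 : 0 < 1 - q := by linarith
  have hγ3 : 3 / 4 ≤ 1 - γ / 2 := by linarith
  set k := q / ((1 - q) * eta₀ N q γ) with hk
  have hk0 : 0 < k := by positivity
  set α := (1 - γ / 2) / (1 - q) with hα
  have hα1 : 3 / 4 ≤ α := by
    rw [hα, le_div_iff₀ hq2]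
    linarith
  rcases ht.eq_or_lt with rfl | htpos
  · have := h 0 le_rfl x
    rw [Real.zero_rpow (by linarith), mul_zero] at this ⊢
    exact this
  have i1 : IntervalIntegrable (fun σ : ℝ => σ ^ (α - 1)) volume 0 t :=
    intervalIntegral.intervalIntegrable_rpow' (by linarith)
  have i2 : IntervalIntegrable
      (fun σ : ℝ => 2 * γ * C * t ^ (α - 3 / 4) * (t - σ) ^ (-(1 / 2 / 2) : ℝ)) volume 0 t :=
    (intervalIntegrable_sub_rpow (by norm_num)).const_mul _
  have hmain := hu.abs_sub_le_integral hN hq0 h0.le hγN hv ht x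
    (g := fun σ => k * L * (σ ^ (α - 1) +
      2 * γ * C * t ^ (α - 3 / 4) * (t - σ) ^ (-(1 / 2 / 2) : ℝ)))
    ((i1.add i2).const_mul _) (fun σ hσ hσt => ?_)
  · rw [intervalIntegral.integral_const_mul, intervalIntegral.integral_add i1 i2,
      intervalIntegral.integral_const_mul, integral_sub_rpow (by norm_num),
      integral_rpow (Or.inl (by linarith)), sub_add_cancel, Real.zero_rpow (by linarith),
      sub_zero] at hmain
    refine hmain.trans (le_of_eq ?_)
    have e : t ^ (α - 3 / 4) * t ^ (1 - 1 / 2 / 2 : ℝ) = t ^ α := by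
      rw [← Real.rpow_add htpos]
      norm_num
    have e2 : t ^ α / α = t ^ α * ((1 - q) / (1 - γ / 2)) := by
      rw [div_eq_mul_inv, hα, inv_div]
    rw [e2]
    calc _ = k * L * (t ^ α * ((1 - q) / (1 - γ / 2)) +
          2 * γ * C * (t ^ (α - 3 / 4) * t ^ (1 - 1 / 2 / 2 : ℝ)) / (1 - 1 / 2 / 2)) := by ring
      _ = _ := by rw [e]; ring
  · have htσ : 0 < t - σ := sub_pos.2 hσt
    obtain ⟨hCi, hCle⟩ := hC _ htσ x
    set B := k * σ⁻¹ * (L * σ ^ α) with hB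
    have hB0 : 0 ≤ B := by positivity
    have hle := norm_integral_le_of_norm_le
      (f := fun y => heatKernel N (t - σ) (x - y) * (‖y‖ ^ (-γ) * (u σ y ^ q - v σ y ^ q)))
      (((integrable_heatKernel htσ x).add (hCi.const_mul (2 * γ * σ ^ (1 / 4 : ℝ)))).const_mul B)
      (ae_of_all _ fun y => ?_)
    · refine hle.trans ?_
      simp only [Pi.add_apply]
      rw [integral_const_mul, integral_add (integrable_heatKernel htσ x) (hCi.const_mul _),
        integral_const_mul, integral_heatKernel htσ]
      have e1 : B = k * L * σ ^ (α - 1) := by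
        rw [hB, Real.rpow_sub_one hσ.ne']
        ring
      have e2 : σ ^ (α - 1) * σ ^ (1 / 4 : ℝ) ≤ t ^ (α - 3 / 4) := by
        rw [← Real.rpow_add hσ, show α - 1 + 1 / 4 = α - 3 / 4 by ring]
        exact Real.rpow_le_rpow hσ.le hσt.le (by linarith)
      calc _ ≤ B * (1 + 2 * γ * σ ^ (1 / 4 : ℝ) * (C * (t - σ) ^ (-(1 / 2 / 2) : ℝ))) := by gcongr
        _ = k * L * (σ ^ (α - 1) + 2 * γ * C * (σ ^ (α - 1) * σ ^ (1 / 4 : ℝ)) *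
            (t - σ) ^ (-(1 / 2 / 2) : ℝ)) := by rw [e1]; ring
        _ ≤ _ := by gcongr
    · have hG := heatKernel_pos htσ (x - y)
      have h1 := norm_rpow_mul_abs_sub_le hq0 hq1 h0 hγ hσ y
        (hu.lowerBound_le hN hq0 hq1 h0.le hγN hu₀ hne hσ.le y)
        (hv.lowerBound_le hN hq0 hq1 h0.le hγN hu₀ hne hσ.le y)
      rw [← hk] at h1
      have h2 := h σ hσ.le y
      rw [norm_mul, norm_mul, Real.norm_of_nonneg hG.le, Real.norm_of_nonneg (by positivity),
        Real.norm_eq_abs]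
      simp only [Pi.add_apply]
      calc _ ≤ heatKernel N (t - σ) (x - y) * (k * σ⁻¹ *
            (1 + 2 * γ * σ ^ (1 / 4 : ℝ) * ‖y‖ ^ (-(1 / 2) : ℝ)) * (L * σ ^ α)) := by
            refine mul_le_mul_of_nonneg_left (h1.trans ?_) hG.le
            gcongr
        _ = _ := by rw [hB]; ring

/-! ### Uniqueness for small `γ` -/

lemma one_sub_le_eta₀ (N : ℕ) {q γ : ℝ} (hq1 : q < 1) (h0 : 0 ≤ γ) :
    1 - γ / (1 - q) * ∫ z : RN N, heatKernel N 1 z * ‖z‖ ≤ eta₀ N q γ := by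
  have hi := integrable_weightedEta N hq1 h0 le_rfl
  have hm := (integrable_heatKernel_one_mul_norm N).const_mul (γ / (1 - q))
  have hsub := (integrable_heatKernel_one N).sub hm
  have h : ∫ z, (heatKernel N 1 z - γ / (1 - q) * (heatKernel N 1 z * ‖z‖)) ≤ eta₀ N q γ := by
    rw [← weightedEta_zero]
    refine integral_mono hsub hi fun z => ?_
    have hG := heatKernel_pos one_pos z
    have hz := norm_nonneg z
    have hp0 := neg_div_one_sub_nonpos hq1 h0
    have h1 : 1 + -γ / (1 - q) * ‖z‖ ≤ (1 + ‖z‖) ^ (-γ / (1 - q)) := by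
      rw [Real.rpow_def_of_pos (by positivity)]
      have h2 := Real.add_one_le_exp (Real.log (1 + ‖z‖) * (-γ / (1 - q)))
      have h3 := Real.log_le_sub_one_of_pos (by positivity : 0 < 1 + ‖z‖)
      have h4 := mul_le_mul_of_nonpos_right h3 hp0
      linarith
    have h5 := mul_le_mul_of_nonneg_left h1 hG.le
    simp only [neg_zero, zero_mul, Real.exp_zero, mul_one]
    refine le_trans (le_of_eq ?_) h5
    ring
  rwa [integral_sub (integrable_heatKernel_one N) hm, integral_heatKernel_one,
    integral_const_mul] at h

/-- If the constant in `IsNonnegSolution.abs_sub_le_of_abs_sub_le` is less than `1`, iterating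
that lemma drives the difference of two solutions to `0`. -/
lemma IsNonnegSolution.eq_of_contraction {N : ℕ} (hN : 1 ≤ N) {q γ : ℝ} (hq0 : 0 < q)
    (hq1 : q < 1) (h0 : 0 < γ) (hγ : γ ≤ 1 / 2) (hγN : γ < min 2 (N : ℝ)) {C : ℝ} (hC0 : 0 < C)
    (hC : ∀ t : ℝ, 0 < t → ∀ x : RN N,
      Integrable (fun y => heatKernel N t (x - y) * ‖y‖ ^ (-(1 / 2) : ℝ)) ∧
      ∫ y, heatKernel N t (x - y) * ‖y‖ ^ (-(1 / 2) : ℝ) ≤ C * t ^ (-(1 / 2 / 2) : ℝ))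
    (hρ : q / ((1 - q) * eta₀ N q γ) * ((1 - q) / (1 - γ / 2) + 8 / 3 * γ * C) < 1)
    {u₀ : C₀(RN N, ℝ)} (hu₀ : ∀ x, 0 ≤ u₀ x) (hne : u₀ ≠ 0) {u v : ℝ → C₀(RN N, ℝ)}
    (hu : IsNonnegSolution N q γ u₀ u) (hv : IsNonnegSolution N q γ u₀ v) {t : ℝ} (ht : 0 ≤ t) :
    u t = v t := by
  have hη := eta₀_pos N hq1 h0.le
  have hq2 : 0 < 1 - q := by linarith
  have hγ3 : 0 < 1 - γ / 2 := by linarith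
  obtain ⟨L, hL, h⟩ := hu.exists_abs_sub_le hN hq0 hq1 h0.le hγN hv
  set ρ := q / ((1 - q) * eta₀ N q γ) * ((1 - q) / (1 - γ / 2) + 8 / 3 * γ * C) with hρdef
  have hρ0 : 0 ≤ ρ := by positivity
  have hiter : ∀ n : ℕ, ∀ t, 0 ≤ t → ∀ x,
      |u t x - v t x| ≤ ρ ^ n * L * t ^ ((1 - γ / 2) / (1 - q)) := by
    intro n
    induction n with
    | zero => simpa using h
    | succ n ih =>
      intro t ht x
      have := hu.abs_sub_le_of_abs_sub_le hN hq0 hq1 h0 hγ hγN hC0 hC hu₀ hne hv (by positivity)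
        ih ht x
      rw [← hρdef, ← mul_assoc, ← pow_succ'] at this
      exact this
  refine ZeroAtInftyContinuousMap.ext fun x => ?_
  have hlim : Tendsto (fun n : ℕ => ρ ^ n * L * t ^ ((1 - γ / 2) / (1 - q))) atTop (𝓝 0) := by
    simpa using ((tendsto_pow_atTop_nhds_zero_of_lt_one hρ0 hρ).mul_const L).mul_const
      (t ^ ((1 - γ / 2) / (1 - q)))
  have := ge_of_tendsto' hlim fun n => hiter n t ht x
  exact sub_eq_zero.1 (abs_nonpos_iff.1 this)

/-- As `γ → 0` the contraction constant tends to `q < 1`, because `η₀ → 1`. -/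
lemma exists_forall_contraction_lt_one (N : ℕ) {q : ℝ} (hq0 : 0 < q) (hq1 : q < 1) {C : ℝ}
    (hC0 : 0 < C) :
    ∃ ε : ℝ, 0 < ε ∧ ∀ γ : ℝ, 0 < γ → γ < ε → γ ≤ 1 / 2 →
      q / ((1 - q) * eta₀ N q γ) * ((1 - q) / (1 - γ / 2) + 8 / 3 * γ * C) < 1 := by
  have hq2 : 0 < 1 - q := by linarith
  set m := ∫ z : RN N, heatKernel N 1 z * ‖z‖ with hm
  have c1 : ContinuousAt (fun γ : ℝ => 1 - γ / (1 - q) * m) 0 := by fun_prop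
  have c2 : ContinuousAt (fun γ : ℝ =>
      q / ((1 - q) * (1 - γ / (1 - q) * m)) * ((1 - q) / (1 - γ / 2) + 8 / 3 * γ * C)) 0 := by
    refine ContinuousAt.mul (continuousAt_const.div (by fun_prop) ?_)
      ((continuousAt_const.div (by fun_prop) ?_).add (by fun_prop))
    · simpa using hq2.ne'
    · norm_num
  have e1 : ∀ᶠ γ : ℝ in 𝓝 0, 0 < 1 - γ / (1 - q) * m :=
    c1.eventually (lt_mem_nhds (by norm_num))
  have hzero : q / ((1 - q) * (1 - 0 / (1 - q) * m)) * ((1 - q) / (1 - 0 / 2) + 8 / 3 * 0 * C)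
      < 1 := by
    simp only [zero_div, zero_mul, mul_zero, sub_zero, mul_one, div_one, add_zero]
    rwa [div_mul_cancel₀ _ hq2.ne']
  have e2 := c2.eventually (gt_mem_nhds hzero)
  obtain ⟨ε, hε, hball⟩ := Metric.eventually_nhds_iff.1 (e1.and e2)
  refine ⟨ε, hε, fun γ h0 hγε hγ => ?_⟩
  obtain ⟨h1, h2⟩ := hball (y := γ) (by rwa [Real.dist_0_eq_abs, abs_of_pos h0])
  have hle := one_sub_le_eta₀ N hq1 h0.le
  rw [← hm] at hle
  have hγ3 : 0 < 1 - γ / 2 := by linarith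
  refine lt_of_le_of_lt ?_ h2
  gcongr

theorem theorem1p2 (N : ℕ) (hN : 1 ≤ N) (q : ℝ) (hq0 : 0 < q) (hq1 : q < 1) :
    (∀ γ : ℝ, 0 < γ → γ < min 2 (N : ℝ) →
      (∀ u₀ : C₀(RN N, ℝ), (∀ x, 0 ≤ u₀ x) → u₀ ≠ 0 →
        ∀ u : ℝ → C₀(RN N, ℝ), IsNonnegSolution N q γ u₀ u →
          (∀ t, 0 < t → ∀ x, 0 < u t x) ∧
          (∀ t, 0 ≤ t → ∀ x, lowerBound N q γ x t ≤ u t x)) ∧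
      (∃ w : ℝ → C₀(RN N, ℝ),
        (∀ t, 0 ≤ t → ∀ x, w t x = lowerBound N q γ x t) ∧
        IsNonnegSubsolution N q γ 0 w)) ∧
    (∃ γs : ℝ, 0 < γs ∧ γs < min 2 (N : ℝ) ∧
      ∀ γ : ℝ, 0 < γ → γ < γs →
        ∀ u₀ : C₀(RN N, ℝ), (∀ x, 0 ≤ u₀ x) → u₀ ≠ 0 →
          ∀ u v : ℝ → C₀(RN N, ℝ),
            IsNonnegSolution N q γ u₀ u → IsNonnegSolution N q γ u₀ v →
              ∀ t, 0 ≤ t → u t = v t) := by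
  refine ⟨fun γ h0 hγ => ⟨fun u₀ hu₀ hne u hu => ⟨fun t ht x => hu.pos hu₀ hne ht x,
    fun t ht x => hu.lowerBound_le hN hq0 hq1 h0.le hγ hu₀ hne ht x⟩,
    exists_isNonnegSubsolution_eq_lowerBound hN hq0 hq1 h0 hγ⟩, ?_⟩
  have hN' : (1 : ℝ) ≤ N := by exact_mod_cast hN
  obtain ⟨C, hC0, hC⟩ := exists_integral_heatKernel_mul_norm_rpow_le hN (γ := 1 / 2) (by norm_num)
    (by linarith)
  obtain ⟨ε, hε, hρ⟩ := exists_forall_contraction_lt_one N hq0 hq1 hC0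
  have hhalf : (1 / 2 : ℝ) < min 2 (N : ℝ) := lt_min (by norm_num) (by linarith)
  refine ⟨min ε (1 / 2), by positivity, (min_le_right _ _).trans_lt hhalf, ?_⟩
  intro γ h0 hγ u₀ hu₀ hne u v hu hv t ht
  have hγ2 : γ < 1 / 2 := hγ.trans_le (min_le_right _ _)
  exact hu.eq_of_contraction hN hq0 hq1 h0 hγ2.le (hγ2.trans hhalf) hC0 hC
    (hρ γ h0 (hγ.trans_le (min_le_left _ _)) hγ2.le) hu₀ hne hv ht
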